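/- For each $N\ge 1$ consider a network of $N$ users (transmitter–receiver pairs) and $N$ channels. Let $h_{m,n,k}$ be the complex random coefficient from the transmitter of user $m$ to the receiver of user $n$ in channel $k$, and write $h_{n,k}=h_{n,n,k}$. User $n$ has transmission power $P_n>0$ and weight $w_n$, and the noise variance is $N_0>0$. For an allocation $\mathbf a=(a_1,\dots,a_N)\in\{1,\dots,N\}^N$ of channels to users put $$I_{n,k}(\mathbf a)=\sum_{m\ne n,\ a_m=k}|h_{m,n,k}|^2P_m,\qquad W(\mathbf a)=\sum_{n=1}^N w_n\log_2\Bigl(1+\frac{P_n|h_{n,a_n}|^2}{N_0+I_{n,a_n}(\mathbf a)}\Bigr),$$ and let $|h_{n,(1)}|\le\dots\le|h_{n,(N)}|$ be the numbers $|h_{n,1}|,\dots,|h_{n,N}|$ in increasing order. In the M-FSIG with parameter $M$ the players are the users, each has the $N$ channels as strategies, and the utility of user $n$ is $$u_n(\mathbf a)=\log_2\Bigl(1+\frac{P_n|h_{n,(N-M+1)}|^2}{N_0+I_{n,a_n}(\mathbf a)}\Bigr)\ \text{ if } |h_{n,a_n}|\ge|h_{n,(N-M+1)}|,\qquad u_n(\mathbf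 a)=0\ \text{ otherwise.}$$ Its pure price of anarchy (PPoA) is $\max_{\mathbf a}W(\mathbf a)/\min_{\mathbf a\in E_p}W(\mathbf a)$, where $E_p$ is the set of its pure Nash equilibria (PNE). Assume that for each $N$ all the coefficients $h_{m,n,k}$ are independent; that for each $n$ the variables $|h_{n,1}|,\dots,|h_{n,N}|$ are Rayleigh distributed with a common scale parameter $\sigma_n>0$, that is, with density $\frac{x}{\sigma_n^2}e^{-x^2/(2\sigma_n^2)}$ on $[0,\infty)$; that $w_{\min}\le w_n\le w_{\max}$ for all $n$ and that the mean signal-to-noise ratios $\mathbb E[P_n|h_{n,k}|^2]/N_0=2P_n\sigma_n^2/N_0$ lie between $\rho_{\min}$ and $\rho_{\max}$ for all $n$, where $w_{\min},w_{\max},\rho_{\min},\rho_{\max}>0$ do not depend on $N$ ($P_n$, $w_n$, $\sigma_n$ may depend on $N$). No assumption is made on the distributions of the interference coefficients $h_{m,n,k}$, $m\ne n$. Let $\varepsilon>0$ and let $M=M_N$ be $(1+\varepsilon)\ln N$, rounded up or down to an integer. Then the ratio $$\frac{W(\mathbf a^*)}{\sum_{n=1}^N w_n\log_2\bigl(1+\frac{P_n}{N_0}|h_{n,(N)}|^2\bigr)}$$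 tends to $1$ in probability as $N\to\infty$, uniformly over the PNE $\mathbf a^*$ of the M-FSIG: for every $\delta>0$, the probability that some PNE $\mathbf a^*$ has a ratio that differs from $1$ by at least $\delta$ tends to $0$. Moreover, the probability that the M-FSIG has a PNE tends to $1$, and consequently its PPoA (defined when there is a PNE) tends to $1$ in probability as $N\to\infty$. -/

import Mathlib

open Filter Topology MeasureTheory ProbabilityTheory

noncomputable section

/-- The Rayleigh distribution with scale parameter `σ`: the law on `ℝ` with density
`x / σ² * exp (-x² / (2σ²))` on `[0, ∞)`. -/
def rayleighMeasure (σ : ℝ) : Measure ℝ :=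
  volume.withDensity fun x =>
    ENNReal.ofReal (if 0 ≤ x then x / σ ^ 2 * Real.exp (-x ^ 2 / (2 * σ ^ 2)) else 0)

/-- A normal-form game with set of players `ι`. -/
structure NormalFormGame (ι : Type) where
  /-- the pure strategies of each player -/
  Strategy : ι → Type
  /-- the utility of each player, as a function of the strategy profile -/
  utility : ι → (∀ i, Strategy i) → ℝ

namespace NormalFormGame

variable {ι : Type} [DecidableEq ι] (G : NormalFormGame ι)

/-- Pure Nash equilibrium: no player gains by a unilateral deviation. -/
def IsPNE (a : ∀ i, G.Strategy i) : Prop :=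
  ∀ (i : ι) (s : G.Strategy i), G.utility i (Function.update a i s) ≤ G.utility i a

/-- The set of pure Nash equilibria. -/
def pneSet : Set (∀ i, G.Strategy i) := {a | G.IsPNE a}

/-- The pure price of anarchy for the performance function `W`: the maximum of `W` over all
strategy profiles, divided by its minimum over the pure Nash equilibria. (For the finite games
below the supremum is attained, and so is the infimum when there is an equilibrium.) -/
def purePriceOfAnarchy (W : (∀ i, G.Strategy i) → ℝ) : ℝ :=
  sSup (Set.range W) / sInf (W '' G.pneSet)

end NormalFormGame

/-- The `i`-th smallest entry of `x`, for `1 ≤ i ≤ N` (and `0` for other `i`). -/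
def orderStat {N : ℕ} (x : Fin N → ℝ) (i : ℕ) : ℝ :=
  if hi : 1 ≤ i ∧ i ≤ N then x (Tuple.sort x ⟨i - 1, by omega⟩) else 0

/-- A realization of a network of `N` transmitter-receiver pairs (users) and `N` channels. -/
structure Network (N : ℕ) where
  /-- `gain m n k` is the coefficient from the transmitter of user `m` to the receiver of user `n`
  in channel `k` -/
  gain : Fin N → Fin N → Fin N → ℂ
  /-- transmission power of each user -/
  power : Fin N → ℝ
  /-- weight of each user in the weighted sum-rate -/
  weight : Fin N → ℝ
  /-- Gaussian noise variance -/
  noise : ℝ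

namespace Network

variable {N : ℕ} (S : Network N)

/-- `|h_{n,k}|`, the modulus of the direct coefficient of user `n` in channel `k`. -/
def directGain (n k : Fin N) : ℝ := ‖S.gain n n k‖

/-- `|h_{n,(i)}|`, the `i`-th smallest of the moduli of the direct coefficients of user `n`. -/
def orderedGain (n : Fin N) (i : ℕ) : ℝ := orderStat (S.directGain n) i

/-- `I_{n,k}(a)`, the interference that user `n` experiences in channel `k` from the other users
when the allocation is `a`. -/
def interference (a : Fin N → Fin N) (n k : Fin N) : ℝ :=
  ∑ m with m ≠ n ∧ a m = k, ‖S.gain m n k‖ ^ 2 * S.power m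

/-- The weighted sum-rate of the allocation `a`. -/
def weightedSumRate (a : Fin N → Fin N) : ℝ :=
  ∑ n, S.weight n *
    Real.logb 2 (1 + S.power n * S.directGain n (a n) ^ 2 / (S.noise + S.interference a n (a n)))

/-- The weighted sum of the rates that the users would have in their best channels without
interference. -/
def idealSumRate : ℝ :=
  ∑ n, S.weight n * Real.logb 2 (1 + S.power n / S.noise * S.orderedGain n N ^ 2)

/-- The M Frequency-Selective Interference Game: the players are the users, their strategies are
the channels, and the utility of a user is nonzero only in her `M` best channels, where it is
computed with the gain of the worst of these `M` channels. -/
def mFSIG (M : ℕ) : NormalFormGame (Fin N) where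
  Strategy := fun _ => Fin N
  utility := fun n a =>
    if S.orderedGain n (N - M + 1) ≤ S.directGain n (a n) then
      Real.logb 2 (1 + S.power n * S.orderedGain n (N - M + 1) ^ 2 /
        (S.noise + S.interference a n (a n)))
    else 0

end Network

end

/-! Dropping the interference and giving every user her best channel bounds `weightedSumRate` by
`idealSumRate`. What remains is the existence of an equilibrium and a lower bound valid for all of
them. Both are deterministic off four events of vanishing probability, and the game enters only
through the bipartite graph joining each user to her `M` best channels.

Existence: a perfect matching of this graph is free of interference, and utilities do not
distinguish among the `M` best channels, so no deviation pays. Lower bound: in an equilibrium every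
user is on one of her `M` best channels, and if she suffers interference none of these is free.
Hence no edge joins the interfered users to the free channels. By counting, the interfered users are
at most twice as many as the free channels, so if they were more than `η * N`, two linear-sized sets
would have no edge between them. The other users get at least the rate of their `M`-th best channel
without interference. Uniformly over users, the best and the `M`-th best gains squared are both of
order `log N` relative to the scale, so the corresponding rates are both asymptotic to `log₂ log N`.

Probability: one user's direct gains are exchangeable, so her `M` best channels avoid `f` given
channels with probability at most `(1 - f / N) ^ M` (`pi_real_disjoint_topSet_le`); distinct users
are independent. A union bound excludes large sets without edges (`measureReal_exists_disjoint_le`).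
For the matching, Hall's theorem and a first-moment bound over minimal violators suffice
(`measureReal_not_exists_injective_le`); there `M ≈ (1 + ε) log N` makes `M * N * exp (-M)` tend to
zero. Only the vanishing or positivity of the interference matters in these estimates, so its law is
irrelevant. -/

/-- The indices of the `M` largest entries of `x` (with ties, all indices that may count among
them). -/
noncomputable def topSet {N : ℕ} (M : ℕ) (x : Fin N → ℝ) : Finset (Fin N) :=
  {k | Finset.card {j | x k < x j} < M}

/-! ### Order statistics and the `M` largest entries, by counting. -/

section TopSet

variable {N M : ℕ} {x : Fin N → ℝ}

lemma mem_topSet {k : Fin N} : k ∈ topSet M x ↔ Finset.card {j | x k < x j} < M := by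
  simp [topSet]

/-- Sorting permutes the entries, so it preserves the number of entries below any level. Counts,
unlike sorts, are visibly measurable and compatible with permutations. -/
lemma orderStat_le_iff {i : ℕ} (h1 : 1 ≤ i) (hi : i ≤ N) (y : ℝ) :
    orderStat x i ≤ y ↔ i ≤ Finset.card {j | x j ≤ y} := by
  have := Tuple.lt_card_le_iff_apply_le_of_monotone (j := (⟨i - 1, by omega⟩ : Fin N)) (a := y)
    (Tuple.monotone_sort x)
  have hc : Finset.card {j | (x ∘ Tuple.sort x) j ≤ y} = Finset.card {j | x j ≤ y} :=
    Finset.card_equiv (Tuple.sort x) (by simp)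
  rw [hc] at this
  rw [orderStat, dif_pos ⟨h1, hi⟩]
  change (x ∘ Tuple.sort x) _ ≤ y ↔ _
  rw [← this]
  simp only
  omega

lemma card_le_add_card_lt (y : ℝ) :
    Finset.card {j | x j ≤ y} + Finset.card {j | y < x j} = N := by
  have := Finset.card_filter_add_card_filter_not (s := (Finset.univ : Finset (Fin N)))
    (fun j => x j ≤ y)
  simpa using this

lemma orderStat_le_iff_card_lt (h1 : 1 ≤ M) (hM : M ≤ N) (y : ℝ) :
    orderStat x (N - M + 1) ≤ y ↔ Finset.card {j | y < x j} < M := by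
  rw [orderStat_le_iff (by omega) (by omega)]
  have := card_le_add_card_lt (x := x) y
  omega

lemma mem_topSet_iff_orderStat_le (h1 : 1 ≤ M) (hM : M ≤ N) {k : Fin N} :
    k ∈ topSet M x ↔ orderStat x (N - M + 1) ≤ x k := by
  rw [mem_topSet, orderStat_le_iff_card_lt h1 hM]

lemma le_orderStat_of_card (h1 : 1 ≤ M) (hM : M ≤ N) {y : ℝ}
    (h : M ≤ Finset.card {j | y ≤ x j}) : y ≤ orderStat x (N - M + 1) := by
  by_contra! hlt
  have h2 := (orderStat_le_iff_card_lt (x := x) h1 hM (orderStat x (N - M + 1))).1 le_rfl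
  refine absurd h2 (not_lt.2 (h.trans (Finset.card_le_card ?_)))
  intro j
  simp only [Finset.mem_filter, Finset.mem_univ, true_and]
  exact hlt.trans_le

lemma exists_orderStat_eq {i : ℕ} (h1 : 1 ≤ i) (hi : i ≤ N) : ∃ k, orderStat x i = x k :=
  ⟨_, by rw [orderStat, dif_pos ⟨h1, hi⟩]⟩

lemma le_orderStat_self (k : Fin N) : x k ≤ orderStat x N := by
  have hN : 1 ≤ N := k.pos
  have h := (orderStat_le_iff (x := x) hN le_rfl (orderStat x N)).1 le_rfl
  have h2 : Finset.filter (fun j => x j ≤ orderStat x N) Finset.univ = Finset.univ :=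
    Finset.eq_univ_of_card _ (le_antisymm (Finset.card_le_univ _) (by simpa using h))
  simpa using (Finset.ext_iff.1 h2 k)

/-- The last `M` positions of the sorted vector always belong to the set; ties can only add indices.
-/
lemma le_card_topSet (h1 : 1 ≤ M) (hM : M ≤ N) : M ≤ (topSet M x).card := by
  have h : (Finset.Ici (⟨N - M, by omega⟩ : Fin N)).map (Tuple.sort x).toEmbedding ⊆
      topSet M x := by
    intro k hk
    simp only [Finset.mem_map, Finset.mem_Ici, Equiv.coe_toEmbedding] at hk
    obtain ⟨i, hi, rfl⟩ := hk
    rw [mem_topSet_iff_orderStat_le h1 hM, orderStat, dif_pos ⟨by omega, by omega⟩]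
    exact Tuple.monotone_sort x hi
  have := Finset.card_le_card h
  rw [Finset.card_map, Fin.card_Ici] at this
  simp only at this
  omega

/-- Without ties the sorted vector is strictly increasing, so nothing beyond its last `M` positions
can enter. -/
lemma card_topSet_le (h1 : 1 ≤ M) (hM : M ≤ N) (hx : Function.Injective x) :
    (topSet M x).card ≤ M := by
  have h : topSet M x ⊆
      (Finset.Ici (⟨N - M, by omega⟩ : Fin N)).map (Tuple.sort x).toEmbedding := by
    intro k hk
    rw [mem_topSet_iff_orderStat_le h1 hM, orderStat, dif_pos ⟨by omega, by omega⟩] at hk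
    simp only [Finset.mem_map, Finset.mem_Ici, Equiv.coe_toEmbedding]
    refine ⟨(Tuple.sort x).symm k, ?_, by simp⟩
    have hs : StrictMono (x ∘ Tuple.sort x) :=
      (Tuple.monotone_sort x).strictMono_of_injective (hx.comp (Tuple.sort x).injective)
    rw [← hs.le_iff_le]
    simpa using hk
  have := Finset.card_le_card h
  rw [Finset.card_map, Fin.card_Ici] at this
  simp only at this
  omega

lemma mem_topSet_comp_perm (e : Equiv.Perm (Fin N)) (k : Fin N) :
    k ∈ topSet M (x ∘ e) ↔ e k ∈ topSet M x := by
  rw [mem_topSet, mem_topSet]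
  rw [Finset.card_equiv e (t := {j | x (e k) < x j}) (by simp)]

lemma measurableSet_mem_topSet (M : ℕ) (k : Fin N) :
    MeasurableSet {x : Fin N → ℝ | k ∈ topSet M x} := by
  simp only [mem_topSet, Finset.card_filter]
  refine measurableSet_lt ?_ measurable_const
  refine Finset.measurable_sum _ fun j _ => ?_
  exact Measurable.ite (measurableSet_lt (measurable_pi_apply k) (measurable_pi_apply j))
    measurable_const measurable_const

lemma measurableSet_disjoint_topSet (M : ℕ) (F : Finset (Fin N)) :
    MeasurableSet {x : Fin N → ℝ | Disjoint (topSet M x) F} := by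
  have : {x : Fin N → ℝ | Disjoint (topSet M x) F} =
      ⋂ k ∈ F, {x : Fin N → ℝ | k ∈ topSet M x}ᶜ := by
    ext x
    simp [Finset.disjoint_right]
  rw [this]
  exact Finset.measurableSet_biInter _ fun k _ => (measurableSet_mem_topSet M k).compl

end TopSet

/-! ### Deterministic analysis of equilibria. -/

namespace Network

variable {N : ℕ} (S : Network N) {M : ℕ}

lemma interference_nonneg (hP : ∀ n, 0 < S.power n) (a : Fin N → Fin N) (n k : Fin N) :
    0 ≤ S.interference a n k :=
  Finset.sum_nonneg fun m _ => mul_nonneg (sq_nonneg _) (hP m).le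

lemma interference_eq_zero {a : Fin N → Fin N} {n k : Fin N} (h : ∀ m, m ≠ n → a m ≠ k) :
    S.interference a n k = 0 := by
  refine Finset.sum_eq_zero fun m hm => ?_
  simp only [Finset.mem_filter, Finset.mem_univ, true_and] at hm
  exact absurd hm.2 (h m hm.1)

lemma logb_rate_mono {p p' I I' : ℝ} (hp : 0 ≤ p) (hpp : p ≤ p') (hI' : 0 < I') (hI : I' ≤ I) :
    Real.logb 2 (1 + p / I) ≤ Real.logb 2 (1 + p' / I') := by
  have : 0 ≤ p / I := div_nonneg hp (hI'.le.trans hI)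
  have h2 : p / I ≤ p' / I' := div_le_div₀ (hp.trans hpp) hpp hI' hI
  exact Real.logb_le_logb_of_le (by norm_num) (by linarith) (by linarith)

lemma logb_rate_nonneg {p I : ℝ} (hp : 0 ≤ p) (hI : 0 ≤ I) : 0 ≤ Real.logb 2 (1 + p / I) :=
  Real.logb_nonneg (by norm_num) (by linarith [div_nonneg hp hI])

/-- An allocation of distinct channels in which every user has one of her `M` best channels is an
equilibrium. -/
lemma mem_pneSet_of_injective (hP : ∀ n, 0 < S.power n) (hN : 0 < S.noise)
    {a : Fin N → Fin N} (ha : Function.Injective a)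
    (hmem : ∀ n, S.orderedGain n (N - M + 1) ≤ S.directGain n (a n)) :
    a ∈ (S.mFSIG M).pneSet := by
  intro n k
  have hz : S.interference a n (a n) = 0 := S.interference_eq_zero fun m hm h => hm (ha h)
  simp only [mFSIG, if_pos (hmem n), hz]
  have hp : 0 ≤ S.power n * S.orderedGain n (N - M + 1) ^ 2 :=
    mul_nonneg (hP n).le (sq_nonneg _)
  -- Within the `M` best channels the numerator is the same and the deviator's denominator is at
  -- least the noise; outside them her utility is zero.
  split_ifs
  · refine logb_rate_mono hp le_rfl (by linarith) ?_
    have := S.interference_nonneg hP (Function.update a n k) n (Function.update a n k n)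
    linarith
  · exact logb_rate_nonneg hp (by linarith)

/-- In an equilibrium every user has one of her `M` best channels. -/
lemma orderedGain_le_of_mem_pneSet (h1 : 1 ≤ M) (hM : M ≤ N) (hP : ∀ n, 0 < S.power n)
    (hN : 0 < S.noise) {a : Fin N → Fin N} (ha : a ∈ (S.mFSIG M).pneSet) (n : Fin N)
    (hpos : 0 < S.orderedGain n (N - M + 1)) :
    S.orderedGain n (N - M + 1) ≤ S.directGain n (a n) := by
  by_contra hlt
  -- The profitable deviation is to the `M`-th best channel itself: it yields a positive utility in
  -- place of zero.
  obtain ⟨k, hk⟩ := exists_orderStat_eq (x := S.directGain n) (i := N - M + 1)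
    (by omega) (by omega)
  have h := ha n k
  have hk' : S.orderedGain n (N - M + 1) ≤ S.directGain n k := hk.le
  simp only [mFSIG, if_neg hlt, Function.update_self, if_pos hk'] at h
  refine absurd h (not_le.2 (Real.logb_pos (by norm_num) ?_))
  have hI := S.interference_nonneg hP (Function.update a n k) n k
  have : 0 < S.power n * S.orderedGain n (N - M + 1) ^ 2 /
      (S.noise + S.interference (Function.update a n k) n k) :=
    div_pos (mul_pos (hP n) (pow_pos hpos 2)) (by linarith)
  linarith

/-- In an equilibrium, the `M` best channels of a user who suffers interference are all in use. -/
lemma not_mem_image_of_mem_pneSet (h1 : 1 ≤ M) (hM : M ≤ N) (hP : ∀ n, 0 < S.power n)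
    (hN : 0 < S.noise) {a : Fin N → Fin N} (ha : a ∈ (S.mFSIG M).pneSet) (n : Fin N)
    (hpos : 0 < S.orderedGain n (N - M + 1)) (hI : 0 < S.interference a n (a n))
    {k : Fin N} (hk : S.orderedGain n (N - M + 1) ≤ S.directGain n k) :
    k ∈ Finset.univ.image a := by
  by_contra hka
  have h := ha n k
  have hmem := S.orderedGain_le_of_mem_pneSet h1 hM hP hN ha n hpos
  have hz : S.interference (Function.update a n k) n k = 0 :=
    S.interference_eq_zero fun m hm h => hka (Finset.mem_image.2 ⟨m, Finset.mem_univ _, by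
      rwa [Function.update_of_ne hm] at h⟩)
  simp only [mFSIG, if_pos hmem, Function.update_self, if_pos hk, hz, add_zero] at h
  have hp : 0 < S.power n * S.orderedGain n (N - M + 1) ^ 2 := mul_pos (hP n) (pow_pos hpos 2)
  refine absurd h (not_le.2 (Real.logb_lt_logb (by norm_num) ?_ ?_))
  · have : 0 < S.noise + S.interference a n (a n) := by linarith
    positivity
  · have := div_lt_div_of_pos_left hp hN (show S.noise < S.noise + S.interference a n (a n) by
      linarith)
    linarith

/-- The users who share their channel are at most twice as many as the free channels. -/
lemma card_shared_le (a : Fin N → Fin N) :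
    Finset.card {n | ∃ m, m ≠ n ∧ a m = a n} ≤ 2 * (Finset.univ \ Finset.univ.image a).card := by
  have hf : (Finset.univ \ Finset.univ.image a).card + (Finset.univ.image a).card = N := by
    rw [Finset.card_sdiff_add_card_eq_card (Finset.subset_univ _)]
    simp
  have hN : ∑ k ∈ Finset.univ.image a, Finset.card {n | a n = k} = N := by
    rw [← Finset.card_eq_sum_card_image]
    simp
  have hC : Finset.card {n | ∃ m, m ≠ n ∧ a m = a n} =
      ∑ k ∈ Finset.univ.image a, Finset.card {n ∈ {n | ∃ m, m ≠ n ∧ a m = a n} | a n = k} :=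
    Finset.card_eq_sum_card_fiberwise fun n _ =>
      Finset.mem_coe.2 (Finset.mem_image_of_mem a (Finset.mem_univ n))
  -- A used channel with `c` users has no sharers if `c = 1` and at most `c ≤ 2 * (c - 1)`
  -- otherwise. Summed over the used channels, this gives sharers `+ 2 *` used `≤ 2 * N`.
  have key : ∀ k ∈ Finset.univ.image a,
      Finset.card {n ∈ {n | ∃ m, m ≠ n ∧ a m = a n} | a n = k} + 2 ≤
        2 * Finset.card {n | a n = k} := by
    intro k hk
    obtain ⟨n₀, -, hn₀⟩ := Finset.mem_image.1 hk
    have hle : Finset.card {n ∈ {n | ∃ m, m ≠ n ∧ a m = a n} | a n = k} ≤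
        Finset.card {n | a n = k} := Finset.card_le_card fun n => by simp
    have hpos : 0 < Finset.card {n | a n = k} := Finset.card_pos.2 ⟨n₀, by simpa using hn₀⟩
    rcases Finset.eq_empty_or_nonempty {n ∈ {n | ∃ m, m ≠ n ∧ a m = a n} | a n = k} with h | h
    · rw [h]
      simp only [Finset.card_empty]
      omega
    · obtain ⟨n, hn⟩ := h
      simp only [Finset.mem_filter, Finset.mem_univ, true_and] at hn
      obtain ⟨⟨m, hmn, hm⟩, hnk⟩ := hn
      have : 1 < Finset.card {n | a n = k} :=
        Finset.one_lt_card.2 ⟨m, by simp [hm, hnk], n, by simp [hnk], hmn⟩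
      omega
  have := Finset.sum_le_sum key
  rw [Finset.sum_add_distrib, ← hC, ← Finset.mul_sum, hN] at this
  simp only [Finset.sum_const, smul_eq_mul] at this
  omega

/-- Only an inclusion in the set of sharers holds, since cross coefficients may vanish. -/
lemma card_interfered_le (a : Fin N → Fin N) :
    Finset.card {n | 0 < S.interference a n (a n)} ≤
      2 * (Finset.univ \ Finset.univ.image a).card := by
  refine le_trans (Finset.card_le_card fun n => ?_) (card_shared_le a)
  simp only [Finset.mem_filter, Finset.mem_univ, true_and]
  intro h
  by_contra! hno
  exact h.ne' (S.interference_eq_zero fun m hm => hno m hm)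

lemma weightedSumRate_le_idealSumRate (hP : ∀ n, 0 < S.power n) (hN : 0 < S.noise)
    (hw : ∀ n, 0 ≤ S.weight n) (a : Fin N → Fin N) : S.weightedSumRate a ≤ S.idealSumRate := by
  refine Finset.sum_le_sum fun n _ => mul_le_mul_of_nonneg_left ?_ (hw n)
  rw [div_mul_eq_mul_div]
  refine logb_rate_mono (mul_nonneg (hP n).le (sq_nonneg _)) ?_ hN ?_
  · refine mul_le_mul_of_nonneg_left ?_ (hP n).le
    exact pow_le_pow_left₀ (norm_nonneg _) (le_orderStat_self (x := S.directGain n) (a n)) 2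
  · linarith [S.interference_nonneg hP a n (a n)]

/-- A lower bound for the weighted sum-rate of an equilibrium in terms of a lower bound `L` for the
rates in the `M`-th best channels and of the number of users who suffer interference. -/
lemma le_weightedSumRate_of_mem_pneSet (h1 : 1 ≤ M) (hM : M ≤ N) (hP : ∀ n, 0 < S.power n)
    (hN : 0 < S.noise) {wmax : ℝ} (hw : ∀ n, 0 ≤ S.weight n ∧ S.weight n ≤ wmax) {L : ℝ}
    (hL : 0 < L) (hrate : ∀ n,
      L ≤ Real.logb 2 (1 + S.power n / S.noise * S.orderedGain n (N - M + 1) ^ 2))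
    (hpos : ∀ n, 0 < S.orderedGain n (N - M + 1))
    {a : Fin N → Fin N} (ha : a ∈ (S.mFSIG M).pneSet) :
    (∑ n, S.weight n) * L - Finset.card {n | 0 < S.interference a n (a n)} * (wmax * L) ≤
      S.weightedSumRate a := by
  have hcard : (Finset.card {n | 0 < S.interference a n (a n)} : ℝ) * (wmax * L) =
      ∑ n, if 0 < S.interference a n (a n) then wmax * L else 0 := by
    rw [← Finset.sum_filter, Finset.sum_const, nsmul_eq_mul]
  rw [hcard, Finset.sum_mul, ← Finset.sum_sub_distrib]
  refine Finset.sum_le_sum fun n _ => ?_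
  have hI := S.interference_nonneg hP a n (a n)
  have hp : 0 ≤ S.power n * S.directGain n (a n) ^ 2 := mul_nonneg (hP n).le (sq_nonneg _)
  -- An interfered user is credited with rate zero, which costs at most `wmax * L`.
  split_ifs with h
  · have h1 : S.weight n * L ≤ wmax * L := mul_le_mul_of_nonneg_right (hw n).2 hL.le
    have h2 := mul_nonneg (hw n).1 (logb_rate_nonneg hp
      (show 0 ≤ S.noise + S.interference a n (a n) by linarith))
    linarith
  · have hz : S.interference a n (a n) = 0 := le_antisymm (not_lt.1 h) hI
    rw [hz, sub_zero, add_zero]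
    refine mul_le_mul_of_nonneg_left ((hrate n).trans ?_) (hw n).1
    rw [div_mul_eq_mul_div]
    refine logb_rate_mono (mul_nonneg (hP n).le (sq_nonneg _)) ?_ hN le_rfl
    refine mul_le_mul_of_nonneg_left ?_ (hP n).le
    exact pow_le_pow_left₀ (hpos n).le (S.orderedGain_le_of_mem_pneSet h1 hM hP hN ha n (hpos n)) 2

/-- The price of anarchy when the sum-rates of the equilibria are at least `c` times the ideal
one. -/
lemma purePriceOfAnarchy_bounds (hP : ∀ n, 0 < S.power n) (hN : 0 < S.noise)
    (hw : ∀ n, 0 ≤ S.weight n) (hideal : 0 < S.idealSumRate) {c : ℝ} (hc : 0 < c)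
    (hne : (S.mFSIG M).pneSet.Nonempty)
    (hlow : ∀ a ∈ (S.mFSIG M).pneSet, c * S.idealSumRate ≤ S.weightedSumRate a) :
    1 ≤ (S.mFSIG M).purePriceOfAnarchy S.weightedSumRate ∧
      (S.mFSIG M).purePriceOfAnarchy S.weightedSumRate ≤ c⁻¹ := by
  obtain ⟨a, ha⟩ := hne
  have himg : (S.weightedSumRate '' (S.mFSIG M).pneSet).Nonempty := ⟨_, a, ha, rfl⟩
  have hinf : c * S.idealSumRate ≤ sInf (S.weightedSumRate '' (S.mFSIG M).pneSet) :=
    le_csInf himg (by rintro _ ⟨b, hb, rfl⟩; exact hlow b hb)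
  have hinf0 : 0 < sInf (S.weightedSumRate '' (S.mFSIG M).pneSet) :=
    (mul_pos hc hideal).trans_le hinf
  have hupper : ∀ y ∈ Set.range S.weightedSumRate, y ≤ S.idealSumRate := by
    rintro _ ⟨b, rfl⟩
    exact S.weightedSumRate_le_idealSumRate hP hN hw b
  have hsup : sSup (Set.range S.weightedSumRate) ≤ S.idealSumRate := csSup_le ⟨_, a, rfl⟩ hupper
  have hbdd : BddBelow (S.weightedSumRate '' (S.mFSIG M).pneSet) :=
    ⟨c * S.idealSumRate, by rintro _ ⟨b, hb, rfl⟩; exact hlow b hb⟩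
  have hle : sInf (S.weightedSumRate '' (S.mFSIG M).pneSet) ≤
      sSup (Set.range S.weightedSumRate) :=
    (csInf_le hbdd ⟨a, ha, rfl⟩).trans (le_csSup ⟨_, hupper⟩ ⟨a, rfl⟩)
  constructor
  · exact (one_le_div hinf0).2 hle
  · refine (div_le_iff₀ hinf0).2 (hsup.trans ?_)
    rw [inv_mul_eq_div, le_div_iff₀ hc]
    linarith

end Network

/-! ### Exchangeability: where the best channels of one user lie. -/

section Averaging

/-- Double counting: a bound on how many of the events occur at once, integrated. When the events
are equiprobable it bounds each of them. -/
lemma sum_measureReal_le_of_ae {α ι : Type*} [MeasurableSpace α] {ν : Measure α}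
    [IsProbabilityMeasure ν] (s : Finset ι) (A : ι → Set α) (hA : ∀ i ∈ s, MeasurableSet (A i))
    {c : ℝ} (h : ∀ᵐ x ∂ν, ∑ i ∈ s, (A i).indicator 1 x ≤ c) : ∑ i ∈ s, ν.real (A i) ≤ c := by
  have hint : ∀ i ∈ s, Integrable ((A i).indicator (1 : α → ℝ)) ν := fun i hi =>
    (integrable_const (1 : ℝ)).indicator (hA i hi)
  calc ∑ i ∈ s, ν.real (A i) = ∑ i ∈ s, ∫ x, (A i).indicator (1 : α → ℝ) x ∂ν :=
        Finset.sum_congr rfl fun i hi => (integral_indicator_one (hA i hi)).symm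
    _ = ∫ x, ∑ i ∈ s, (A i).indicator (1 : α → ℝ) x ∂ν := (integral_finsetSum _ hint).symm
    _ ≤ ∫ _, c ∂ν := integral_mono_ae (integrable_finsetSum _ hint) (integrable_const c) h
    _ = c := by simp

lemma exists_perm_map_eq {α : Type*} [Fintype α] [DecidableEq α] {F F' : Finset α}
    (h : F.card = F'.card) : ∃ e : Equiv.Perm α, ∀ k, e k ∈ F' ↔ k ∈ F := by
  let e₀ : {x // x ∈ F} ≃ {x // x ∈ F'} := Finset.equivOfCardEq h
  refine ⟨e₀.extendSubtype, fun k => ⟨fun hk => ?_, fun hk => e₀.extendSubtype_mem k hk⟩⟩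
  by_contra hk'
  exact e₀.extendSubtype_not_mem k hk' hk

end Averaging

section Exchangeable

variable {N M : ℕ} (ρ : Measure ℝ) [IsProbabilityMeasure ρ]

lemma pi_real_preimage_comp_perm (e : Equiv.Perm (Fin N)) {s : Set (Fin N → ℝ)}
    (hs : MeasurableSet s) :
    (Measure.pi fun _ : Fin N => ρ).real {x | x ∘ e ∈ s} =
      (Measure.pi fun _ : Fin N => ρ).real s := by
  have h := measurePreserving_piCongrLeft (α := fun _ : Fin N => ℝ) (fun _ => ρ) e.symm
  have h2 := h.measureReal_preimage hs.nullMeasurableSet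
  rw [← h2]
  congr 1
  ext x
  have : MeasurableEquiv.piCongrLeft (fun _ : Fin N => ℝ) e.symm x = x ∘ e := by
    ext k
    have := Equiv.piCongrLeft_apply_apply (fun _ : Fin N => ℝ) e.symm x (e k)
    rw [Equiv.symm_apply_apply] at this
    exact this
  rw [Set.mem_preimage, this]
  rfl

lemma pi_real_disjoint_topSet_congr {F F' : Finset (Fin N)} (h : F.card = F'.card) :
    (Measure.pi fun _ : Fin N => ρ).real {x | Disjoint (topSet M x) F} =
      (Measure.pi fun _ : Fin N => ρ).real {x | Disjoint (topSet M x) F'} := by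
  obtain ⟨e, he⟩ := exists_perm_map_eq h
  rw [← pi_real_preimage_comp_perm ρ e (measurableSet_disjoint_topSet M F)]
  congr 1
  ext x
  simp only [Set.mem_ofPred_eq, Finset.disjoint_left, mem_topSet_comp_perm]
  constructor
  · intro H k hk hk'
    exact H (a := e.symm k) (by simpa using hk) (by rw [← he]; simpa using hk')
  · intro H k hk hk'
    exact H hk ((he k).2 hk')

lemma pi_real_mem_topSet_congr (k l : Fin N) :
    (Measure.pi fun _ : Fin N => ρ).real {x | k ∈ topSet M x} =
      (Measure.pi fun _ : Fin N => ρ).real {x | l ∈ topSet M x} := by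
  rw [← pi_real_preimage_comp_perm ρ (Equiv.swap k l) (measurableSet_mem_topSet M k)]
  congr 1
  ext x
  simp [mem_topSet_comp_perm]

/-- Factor by factor, `(a - i) / (N - i) ≤ a / N`. -/
lemma descFactorial_mul_pow_le {a N : ℕ} (h : a ≤ N) (M : ℕ) :
    a.descFactorial M * N ^ M ≤ N.descFactorial M * a ^ M := by
  induction M with
  | zero => simp
  | succ M ih =>
    rw [Nat.descFactorial_succ, Nat.descFactorial_succ, pow_succ, pow_succ]
    have h1 : (a - M) * N ≤ (N - M) * a := by
      rw [Nat.sub_mul, Nat.sub_mul, Nat.mul_comm N a]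
      exact Nat.sub_le_sub_left (Nat.mul_le_mul_left M h) _
    calc (a - M) * a.descFactorial M * (N ^ M * N)
        = (a.descFactorial M * N ^ M) * ((a - M) * N) := by ring
      _ ≤ (N.descFactorial M * a ^ M) * ((N - M) * a) := Nat.mul_le_mul ih h1
      _ = _ := by ring

lemma choose_sub_div_choose_le {f : ℕ} (hMN : M ≤ N) (hf : f ≤ N) :
    ((N - M).choose f : ℝ) ≤ (1 - f / N) ^ M * N.choose f := by
  rcases Nat.eq_zero_or_pos N with rfl | hN
  · obtain rfl : f = 0 := by omega
    simp
  by_cases hM : M ≤ N - f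
  swap
  · rw [Nat.choose_eq_zero_of_lt (by omega), Nat.cast_zero]
    have : (f : ℝ) / N ≤ 1 := (div_le_one (by positivity)).2 (by exact_mod_cast hf)
    have : 0 ≤ 1 - (f : ℝ) / N := by linarith
    positivity
  have hN' : (0 : ℝ) < N := by exact_mod_cast hN
  -- Both sides count pairs of disjoint subsets of sizes `f` and `M`.
  have h1 : N.choose f * (N - f).choose M = N.choose M * (N - M).choose f := by
    have := Nat.choose_mul (n := N) (k := f + M) (s := f) (by omega)
    have h2 := Nat.choose_mul (n := N) (k := f + M) (s := M) (by omega)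
    simp only [Nat.add_sub_cancel_left, Nat.add_sub_cancel] at this h2
    rw [← this, ← h2, Nat.choose_symm_add]
  have h3 : (N - f).choose M * N ^ M ≤ N.choose M * (N - f) ^ M := by
    have := descFactorial_mul_pow_le (Nat.sub_le N f) M
    rw [Nat.descFactorial_eq_factorial_mul_choose, Nat.descFactorial_eq_factorial_mul_choose,
      mul_assoc, mul_assoc] at this
    exact Nat.le_of_mul_le_mul_left this (Nat.factorial_pos M)
  have hpos : (0 : ℝ) < N.choose M := by exact_mod_cast Nat.choose_pos (by omega : M ≤ N)
  have h1' : (N.choose f : ℝ) * (N - f).choose M = N.choose M * (N - M).choose f := by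
    exact_mod_cast h1
  have h3' : ((N - f).choose M : ℝ) ≤ N.choose M * (1 - f / N) ^ M := by
    have h4 : ((N - f).choose M : ℝ) * N ^ M ≤ N.choose M * (N - f) ^ M := by
      have h5 : ((N - f : ℕ) : ℝ) = (N : ℝ) - f := Nat.cast_sub hf
      rw [← h5]
      exact_mod_cast h3
    have h6 : (1 - (f : ℝ) / N) = (N - f) / N := by field_simp
    rw [h6, div_pow, ← mul_div_assoc, le_div_iff₀ (by positivity)]
    exact h4
  refine le_of_mul_le_mul_left ?_ hpos
  rw [← h1']
  calc (N.choose f : ℝ) * (N - f).choose M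
      ≤ N.choose f * (N.choose M * (1 - f / N) ^ M) := by gcongr
    _ = _ := by ring

/-- At most `(N - M).choose f` of the `N.choose f` sets of size `f` avoid the best channels, and all
are equally likely to do so. Ties only help here, so no continuity of the law is required. -/
lemma pi_real_disjoint_topSet_le (h1 : 1 ≤ M) (hM : M ≤ N) (F : Finset (Fin N)) :
    (Measure.pi fun _ : Fin N => ρ).real {x | Disjoint (topSet M x) F} ≤
      (1 - F.card / N) ^ M := by
  have hf : F.card ≤ N := by simpa using Finset.card_le_univ F
  have hsum := sum_measureReal_le_of_ae (ν := Measure.pi fun _ : Fin N => ρ)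
    (Finset.powersetCard F.card Finset.univ)
    (fun F' => {x | Disjoint (topSet M x) F'}) (fun F' _ => measurableSet_disjoint_topSet M F')
    (c := (N - M).choose F.card) (ae_of_all _ fun x => by
      have : ∑ F' ∈ Finset.powersetCard F.card Finset.univ,
          Set.indicator {x | Disjoint (topSet M x) F'} (1 : (Fin N → ℝ) → ℝ) x =
          ((Finset.powersetCard F.card (topSet M x)ᶜ).card : ℝ) := by
        simp only [Set.indicator_apply, Set.mem_ofPred_eq, Pi.one_apply]
        rw [← Finset.sum_filter, Finset.sum_const, nsmul_one]
        congr 2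
        ext F'
        simp only [Finset.mem_filter, Finset.mem_powersetCard, Finset.subset_univ, true_and,
          Finset.subset_compl_iff_disjoint_left]
        tauto
      rw [this, Finset.card_powersetCard, Finset.card_compl, Fintype.card_fin]
      exact_mod_cast Nat.choose_le_choose _ (Nat.sub_le_sub_left (le_card_topSet h1 hM) N))
  rw [Finset.sum_congr rfl fun F' hF' => pi_real_disjoint_topSet_congr ρ (F' := F)
    (Finset.mem_powersetCard.1 hF').2, Finset.sum_const, Finset.card_powersetCard,
    Finset.card_univ, Fintype.card_fin, nsmul_eq_mul] at hsum
  have hpos : (0 : ℝ) < N.choose F.card := by exact_mod_cast Nat.choose_pos hf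
  refine le_of_mul_le_mul_left (hsum.trans ((choose_sub_div_choose_le hM hf).trans_eq ?_)) hpos
  ring

lemma ae_injective_pi [NullSingletonClass ρ] :
    ∀ᵐ x ∂(Measure.pi fun _ : Fin N => ρ), Function.Injective x := by
  have h : ∀ i j : Fin N, i ≠ j → ∀ᵐ x ∂(Measure.pi fun _ : Fin N => ρ), x i ≠ x j := by
    intro i j hij
    have hind : iIndepFun (fun (i : Fin N) (x : Fin N → ℝ) => x i)
        (Measure.pi fun _ : Fin N => ρ) :=
      iIndepFun_pi (X := fun _ y => y) (μ := fun _ : Fin N => ρ) fun _ => aemeasurable_id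
    have hm := (indepFun_iff_map_prod_eq_prod_map_map (measurable_pi_apply i).aemeasurable
      (measurable_pi_apply j).aemeasurable).1 (hind.indepFun hij)
    have hmi : ∀ i : Fin N, (Measure.pi fun _ : Fin N => ρ).map (fun x => x i) = ρ := fun i =>
      (measurePreserving_eval (fun _ : Fin N => ρ) i).map_eq
    rw [hmi i, hmi j] at hm
    have hdiag : (ρ.prod ρ) (Set.diagonal ℝ) = 0 := by
      rw [Measure.measure_prod_null measurableSet_diagonal]
      refine ae_of_all _ fun y => ?_
      have : Prod.mk y ⁻¹' Set.diagonal ℝ = {y} := by ext z; simp [eq_comm]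
      simp [this]
    rw [← hm, Measure.map_apply (by fun_prop) measurableSet_diagonal] at hdiag
    exact measure_eq_zero_iff_ae_notMem.1 hdiag
  have h' : ∀ᵐ x ∂(Measure.pi fun _ : Fin N => ρ), ∀ i j, i ≠ j → x i ≠ x j := by
    simp only [ae_all_iff]
    exact h
  filter_upwards [h'] with x hx i j hij
  by_contra hne
  exact hx i j hne hij

/-- The `N` equal probabilities sum to the expected size of the set, which is at most `M` because
there are almost surely no ties. -/
lemma pi_real_mem_topSet_le [NullSingletonClass ρ] (h1 : 1 ≤ M) (hM : M ≤ N) (k : Fin N) :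
    (Measure.pi fun _ : Fin N => ρ).real {x | k ∈ topSet M x} ≤ M / N := by
  have hsum := sum_measureReal_le_of_ae (ν := Measure.pi fun _ : Fin N => ρ) Finset.univ
    (fun k => {x | k ∈ topSet M x}) (fun k _ => measurableSet_mem_topSet M k) (c := M) (by
      filter_upwards [ae_injective_pi ρ] with x hx
      have : ∑ k : Fin N, Set.indicator {x | k ∈ topSet M x} (1 : (Fin N → ℝ) → ℝ) x =
          ((topSet M x).card : ℝ) := by
        simp [Set.indicator_apply]
      rw [this]
      exact_mod_cast card_topSet_le h1 hM hx)
  rw [Finset.sum_congr rfl fun l _ => pi_real_mem_topSet_congr ρ (l : Fin N) k, Finset.sum_const,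
    Finset.card_univ, Fintype.card_fin, nsmul_eq_mul] at hsum
  have hN : (0 : ℝ) < N := by exact_mod_cast k.pos
  rw [le_div_iff₀ hN]
  linarith

lemma pi_real_not_disjoint_topSet_le [NullSingletonClass ρ] (h1 : 1 ≤ M) (hM : M ≤ N) (F : Finset (Fin N)) :
    (Measure.pi fun _ : Fin N => ρ).real {x | ¬ Disjoint (topSet M x) F} ≤ F.card * (M / N) := by
  have : {x : Fin N → ℝ | ¬ Disjoint (topSet M x) F} = ⋃ k ∈ F, {x | k ∈ topSet M x} := by
    ext x
    simp [Finset.disjoint_right]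
  rw [this]
  refine (measureReal_biUnion_finset_le F _).trans ?_
  refine (Finset.sum_le_sum fun k _ => pi_real_mem_topSet_le ρ h1 hM k).trans ?_
  rw [Finset.sum_const, nsmul_eq_mul]

end Exchangeable

/-! ### Independence between users. -/

section Independence

variable {Ω : Type*} [MeasurableSpace Ω] {μ : Measure Ω}

/-- Independence is a statement about the joint law, and currying turns a product over pairs into a
product of products. -/
lemma iIndepFun_curry {ι κ E : Type*} [Fintype ι] [Fintype κ] [MeasurableSpace E]
    {X : ι → κ → Ω → E} (hX : ∀ i j, Measurable (X i j))
    (h : iIndepFun (fun p : ι × κ => X p.1 p.2) μ) :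
    iIndepFun (fun i ω j => X i j ω) μ := by
  have := h.isProbabilityMeasure
  have h' : iIndepFun (fun (p : (_ : ι) × κ) ω => X p.1 p.2 ω) μ :=
    h.precomp (g := Equiv.sigmaEquivProd ι κ) (Equiv.injective _)
  have : ∀ i j, IsProbabilityMeasure (μ.map (X i j)) :=
    fun i j => Measure.isProbabilityMeasure_map (hX i j).aemeasurable
  have hrow : ∀ i, iIndepFun (X i) μ := fun i =>
    h.precomp (g := fun j => (i, j)) (Prod.mk_right_injective i)
  rw [iIndepFun_iff_map_fun_eq_infinitePi_map (by fun_prop)]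
  rw [iIndepFun_iff_map_fun_eq_infinitePi_map (by fun_prop)] at h'
  have hc : (MeasurableEquiv.piCurry fun (_ : ι) (_ : κ) => E) ∘
      (fun ω (p : (_ : ι) × κ) => X p.1 p.2 ω) = fun ω i j => X i j ω := by
    ext; simp [Sigma.curry]
  rw [← hc, ← Measure.map_map (by fun_prop) (by fun_prop), h',
    Measure.infinitePi_map_piCurry (fun i j => μ.map (X i j))]
  congr 1
  funext i
  rw [← (iIndepFun_iff_map_fun_eq_infinitePi_map (by fun_prop)).1 (hrow i)]

variable {N M : ℕ} {X : Fin N → Ω → Fin N → ℝ} {ρ : Fin N → Measure ℝ}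
  [∀ n, IsProbabilityMeasure (ρ n)]

lemma measureReal_preimage_of_hasLaw {α : Type*} [MeasurableSpace α] {Y : Ω → α} {ν : Measure α}
    (hY : HasLaw Y ν μ) {s : Set α} (hs : MeasurableSet s) : μ.real (Y ⁻¹' s) = ν.real s := by
  rw [← hY.map_eq, map_measureReal_apply_of_aemeasurable hY.aemeasurable hs]

lemma measureReal_forall_disjoint_le [IsProbabilityMeasure μ] (hX : iIndepFun X μ)
    (hlaw : ∀ n, HasLaw (X n) (Measure.pi fun _ => ρ n) μ)
    (h1 : 1 ≤ M) (hM : M ≤ N) (U F : Finset (Fin N)) :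
    μ.real {ω | ∀ n ∈ U, Disjoint (topSet M (X n ω)) F} ≤ ((1 - F.card / N) ^ M) ^ U.card := by
  have h := hX.measure_inter_preimage_eq_mul U
    (sets := fun _ => {x | Disjoint (topSet M x) F}) fun _ _ => measurableSet_disjoint_topSet M F
  have heq : {ω | ∀ n ∈ U, Disjoint (topSet M (X n ω)) F} =
      ⋂ n ∈ U, X n ⁻¹' {x | Disjoint (topSet M x) F} := by
    ext ω; simp
  rw [heq, Measure.real, h, ENNReal.toReal_prod, ← Finset.prod_const]
  refine Finset.prod_le_prod (fun _ _ => ENNReal.toReal_nonneg) fun n _ => ?_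
  change μ.real _ ≤ _
  rw [measureReal_preimage_of_hasLaw (hlaw n) (measurableSet_disjoint_topSet M F)]
  exact pi_real_disjoint_topSet_le (ρ n) h1 hM F

/-- The event says that `U` is exactly the neighbourhood of `F`, so users in `U` contribute a factor
as well. That factor cancels one of the two binomial coefficients when `F` is small; the trivial
bound `1` suffices when `F` is large. -/
lemma measureReal_forall_disjoint_iff_le [IsProbabilityMeasure μ] [∀ n, NullSingletonClass (ρ n)]
    (hX : iIndepFun X μ) (hlaw : ∀ n, HasLaw (X n) (Measure.pi fun _ => ρ n) μ)
    (h1 : 1 ≤ M) (hM : M ≤ N) (U F : Finset (Fin N)) :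
    μ.real {ω | ∀ n, Disjoint (topSet M (X n ω)) F ↔ n ∉ U} ≤
      ((1 - F.card / N) ^ M) ^ (N - U.card) * (min (1 : ℝ) (F.card * (M / N))) ^ U.card := by
  classical
  have hms : ∀ n, MeasurableSet {x : Fin N → ℝ | Disjoint (topSet M x) F ↔ n ∉ U} := by
    intro n
    by_cases hn : n ∈ U
    · simp only [hn, not_true_eq_false, iff_false]
      exact (measurableSet_disjoint_topSet M F).compl
    · simp only [hn, not_false_eq_true, iff_true]
      exact measurableSet_disjoint_topSet M F
  have h := hX.measure_inter_preimage_eq_mul Finset.univ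
    (sets := fun n => {x | Disjoint (topSet M x) F ↔ n ∉ U}) fun n _ => hms n
  have heq : {ω | ∀ n, Disjoint (topSet M (X n ω)) F ↔ n ∉ U} =
      ⋂ n ∈ Finset.univ, X n ⁻¹' {x | Disjoint (topSet M x) F ↔ n ∉ U} := by
    ext ω; simp
  rw [heq, Measure.real, h, ENNReal.toReal_prod]
  have hb : ∀ n ∈ Finset.univ, (μ (X n ⁻¹' {x | Disjoint (topSet M x) F ↔ n ∉ U})).toReal ≤
      if n ∈ U then min 1 ((F.card : ℝ) * (M / N)) else (1 - (F.card : ℝ) / N) ^ M := by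
    intro n _
    change μ.real _ ≤ _
    rw [measureReal_preimage_of_hasLaw (hlaw n) (hms n)]
    split_ifs with hn
    · refine le_min measureReal_le_one ?_
      simpa [hn] using pi_real_not_disjoint_topSet_le (ρ n) h1 hM F
    · simpa [hn] using pi_real_disjoint_topSet_le (ρ n) h1 hM F
  refine (Finset.prod_le_prod (fun _ _ => ENNReal.toReal_nonneg) hb).trans_eq ?_
  rw [Finset.prod_ite, Finset.prod_const, Finset.prod_const, mul_comm]
  have hc1 : Finset.filter (fun n => n ∈ U) Finset.univ = U := by ext; simp
  have hc2 : Finset.filter (fun n => n ∉ U) Finset.univ = Uᶜ := by ext; simp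
  rw [hc1, hc2, Finset.card_compl, Fintype.card_fin]

end Independence

/-! ### Perfect matchings and pairs of sets without edges. -/

section Hall

variable {N : ℕ}

/-- Either every user can be given a channel of her own from `A n`, or there are a set of channels
and a smaller set of users, by exactly one, who are those that accept some of these channels. -/
lemma exists_injective_or_exists_violator (A : Fin N → Finset (Fin N)) :
    (∃ a : Fin N → Fin N, Function.Injective a ∧ ∀ n, a n ∈ A n) ∨
      ∃ F U : Finset (Fin N), F.card = U.card + 1 ∧ ∀ n, Disjoint (A n) F ↔ n ∉ U := by
  -- Hall's condition is imposed on channels rather than users; an injection of `Fin N` into itself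
  -- is a bijection, so the matching can be inverted.
  let t : Fin N → Finset (Fin N) := fun k => {n | k ∈ A n}
  by_cases h : ∀ s : Finset (Fin N), s.card ≤ (s.biUnion t).card
  · obtain ⟨f, hf, hft⟩ := (Finset.all_card_le_biUnion_card_iff_exists_injective t).1 h
    left
    let e := Equiv.ofBijective f (Finite.injective_iff_bijective.1 hf)
    refine ⟨e.symm, e.symm.injective, fun n => ?_⟩
    have := hft (e.symm n)
    have he : f (e.symm n) = n := e.apply_symm_apply n
    simpa [t, he] using this
  · right
    push Not at h
    obtain ⟨s₀, hs₀⟩ := h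
    -- In a violator of least size, removing one channel restores Hall's inequality, so the
    -- deficiency is exactly one.
    obtain ⟨F, hF, hmin⟩ := Finset.exists_min_image
      (Finset.univ.filter fun s : Finset (Fin N) => (s.biUnion t).card < s.card) Finset.card
      ⟨s₀, by simpa using hs₀⟩
    simp only [Finset.mem_filter, Finset.mem_univ, true_and] at hF hmin
    refine ⟨F, F.biUnion t, ?_, fun n => ?_⟩
    · obtain ⟨k, hk⟩ : F.Nonempty := Finset.card_pos.1 (by omega)
      have h1 : (F.erase k).card ≤ ((F.erase k).biUnion t).card := by
        by_contra! hlt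
        have := hmin _ hlt
        rw [Finset.card_erase_of_mem hk] at this
        have := Finset.card_pos.2 ⟨k, hk⟩
        omega
      have h2 := Finset.card_le_card (Finset.biUnion_subset_biUnion_of_subset_left t
        (Finset.erase_subset k F))
      rw [Finset.card_erase_of_mem hk] at h1
      omega
    · simp [t, Finset.disjoint_right]

lemma choose_le_exp_mul_div_pow {t : ℕ} (ht : 1 ≤ t) :
    (N.choose t : ℝ) ≤ (Real.exp 1 * (N / t)) ^ t := by
  have ht0 : (0 : ℝ) < t := by exact_mod_cast ht
  refine (Nat.choose_le_pow_div t N).trans ?_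
  have h := Real.pow_div_factorial_le_exp _ ht0.le t
  rw [mul_pow, ← Real.exp_nat_mul, mul_one, div_pow]
  calc (N : ℝ) ^ t / t.factorial = (t ^ t / t.factorial) * (N ^ t / t ^ t) := by
        field_simp
    _ ≤ _ := by gcongr

/-- The bound for the expected number of Hall violators with `t` channels, when `t` is small. -/
lemma choose_mul_choose_mul_le_of_two_mul_le {M t : ℕ} (hM : 1 ≤ M) (ht : 1 ≤ t)
    (htN : 2 * t ≤ N) :
    (N.choose t : ℝ) * N.choose (t - 1) * (((1 - t / N) ^ M) ^ (N - (t - 1)) *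
      (min (1 : ℝ) (t * (M / N))) ^ (t - 1)) ≤
      (Real.exp 1 ^ 2 * M *
        (Real.exp 1 * N * Real.exp (-M) + M * Real.exp (-(M / 2)))) ^ t := by
  obtain ⟨j, rfl⟩ : ∃ j, t = j + 1 := ⟨t - 1, by omega⟩
  simp only [Nat.add_sub_cancel]
  set t : ℝ := ((j + 1 : ℕ) : ℝ) with ht_def
  have ht0 : 0 < t := by positivity
  have hN0 : (0 : ℝ) < N := by exact_mod_cast (by omega : 0 < N)
  have hM0 : (1 : ℝ) ≤ M := by exact_mod_cast hM
  have htN2 : t / N ≤ 1 / 2 := by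
    rw [div_le_iff₀ hN0]
    have : (2 : ℝ) * t ≤ N := by rw [ht_def]; exact_mod_cast htN
    linarith
  have hc1 : (N.choose (j + 1) : ℝ) ≤ (Real.exp 1 * (N / t)) ^ (j + 1) :=
    choose_le_exp_mul_div_pow ht
  -- The powers of `N` cancel between the binomial and the hitting probabilities, leaving `t ^ j * M
  -- ^ j / j!`.
  have hc2 : (N.choose j : ℝ) * (min (1 : ℝ) (t * (M / N))) ^ j ≤ (Real.exp 1 * M) ^ (j + 1) := by
    calc (N.choose j : ℝ) * (min (1 : ℝ) (t * (M / N))) ^ j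
        ≤ (N ^ j / j.factorial) * (t * (M / N)) ^ j := by
          gcongr
          · exact Nat.choose_le_pow_div j N
          · exact min_le_right _ _
      _ = (t ^ (j + 1) / (j + 1).factorial) * M ^ j := by
          rw [Nat.factorial_succ, Nat.cast_mul, ← ht_def]
          field_simp
          rw [div_pow, mul_pow]
          field_simp
          rw [pow_succ']
      _ ≤ Real.exp t * M ^ (j + 1) := by
          gcongr
          · exact Real.pow_div_factorial_le_exp _ ht0.le _
          · omega
      _ = (Real.exp 1 * M) ^ (j + 1) := by
          rw [mul_pow, ← Real.exp_nat_mul, mul_one]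
  have he : ((1 - t / N) ^ M) ^ (N - j) ≤ Real.exp (-(M * (1 - t / N))) ^ (j + 1) := by
    have h0 : 0 ≤ 1 - t / N := by linarith
    have h1 : 1 - t / N ≤ Real.exp (-(t / N)) := by linarith [Real.add_one_le_exp (-(t / N))]
    calc ((1 - t / N) ^ M) ^ (N - j) ≤ (Real.exp (-(t / N)) ^ M) ^ (N - j) := by gcongr
      _ = Real.exp (((N - j : ℕ) * (M * (-(t / N))))) := by
          rw [← Real.exp_nat_mul, ← Real.exp_nat_mul]
      _ ≤ Real.exp ((j + 1 : ℕ) * (-(M * (1 - t / N)))) := by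
          rw [Real.exp_le_exp, Nat.cast_sub (by omega), ← ht_def]
          have hj : (j : ℝ) = t - 1 := by rw [ht_def]; push_cast; ring
          have h3 : 0 ≤ M * (t / N) := by positivity
          have h4 : t * (-(M * (1 - t / N))) = -(N - t) * (M * (t / N)) := by
            field_simp
          rw [hj, h4]
          nlinarith
      _ = _ := by rw [Real.exp_nat_mul]
  have hfin : N / t * Real.exp (-(M * (1 - t / N))) ≤
      Real.exp 1 * N * Real.exp (-M) + M * Real.exp (-(M / 2)) := by
    -- If `t * M ≤ N`, replacing `1 - t / N` by `1` in the exponent costs at most a factor `e`.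
    -- Otherwise `N / t < M`, and `t ≤ N / 2` leaves half of the exponent.
    by_cases hcase : t * M ≤ N
    · have h1 : N / t ≤ (N : ℝ) := div_le_self hN0.le (by rw [ht_def]; push_cast; linarith [
        (Nat.cast_nonneg j : (0 : ℝ) ≤ j)])
      have h2 : Real.exp (-(M * (1 - t / N))) ≤ Real.exp 1 * Real.exp (-M) := by
        rw [← Real.exp_add, Real.exp_le_exp]
        have : M * (t / N) ≤ 1 := by
          rw [← mul_div_assoc, div_le_one hN0]
          linarith
        linarith
      calc N / t * Real.exp (-(M * (1 - t / N))) ≤ N * (Real.exp 1 * Real.exp (-M)) := by gcongr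
        _ = Real.exp 1 * N * Real.exp (-M) := by ring
        _ ≤ _ := le_add_of_nonneg_right (by positivity)
    · have h1 : N / t ≤ (M : ℝ) := by
        rw [div_le_iff₀ ht0]
        linarith
      have h2 : Real.exp (-(M * (1 - t / N))) ≤ Real.exp (-(M / 2)) := by
        rw [Real.exp_le_exp]
        nlinarith
      calc N / t * Real.exp (-(M * (1 - t / N))) ≤ M * Real.exp (-(M / 2)) := by gcongr
        _ ≤ _ := le_add_of_nonneg_left (by positivity)
  have hmin : 0 ≤ min (1 : ℝ) (t * (M / N)) := le_min zero_le_one (by positivity)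
  have h0 : 0 ≤ 1 - t / N := by linarith
  calc (N.choose (j + 1) : ℝ) * N.choose j * (((1 - t / N) ^ M) ^ (N - j) *
        (min (1 : ℝ) (t * (M / N))) ^ j)
      = N.choose (j + 1) * (N.choose j * (min (1 : ℝ) (t * (M / N))) ^ j) *
        ((1 - t / N) ^ M) ^ (N - j) := by ring
    _ ≤ (Real.exp 1 * (N / t)) ^ (j + 1) * (Real.exp 1 * M) ^ (j + 1) *
        Real.exp (-(M * (1 - t / N))) ^ (j + 1) := by gcongr
    _ = (Real.exp 1 ^ 2 * M * (N / t * Real.exp (-(M * (1 - t / N))))) ^ (j + 1) := by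
        rw [← mul_pow, ← mul_pow]
        ring
    _ ≤ _ := pow_le_pow_left₀ (by positivity) (mul_le_mul_of_nonneg_left hfin (by positivity)) _

/-- The bound for the expected number of Hall violators with `t` channels, when `t` is large. -/
lemma choose_mul_choose_mul_le_of_lt_two_mul {M t : ℕ} (hM : 2 ≤ M) (ht : 1 ≤ t) (htN : t ≤ N)
    (h2t : N < 2 * t) {c : ℝ} (hc0 : 0 ≤ c) (hc1 : c ≤ 1) :
    (N.choose t : ℝ) * N.choose (t - 1) * (((1 - t / N) ^ M) ^ (N - (t - 1)) * c ^ (t - 1)) ≤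
      (Real.exp 1 ^ 2 * (1 / 2) ^ (M - 2)) ^ (N - (t - 1)) := by
  obtain ⟨u, hu⟩ : ∃ u, u = N - t := ⟨_, rfl⟩
  obtain ⟨m, rfl⟩ : ∃ m, M = m + 2 := ⟨M - 2, by omega⟩
  have hs : N - (t - 1) = u + 1 := by omega
  have hN0 : (0 : ℝ) < N := by exact_mod_cast (by omega : 0 < N)
  have hut : (1 - (t : ℝ) / N) = u / N := by
    rw [hu, Nat.cast_sub htN]
    field_simp
  rw [hs, hut, Nat.add_sub_cancel]
  -- With `u = N - t`, both binomials are bounded by `N ^ (u + 1) / (u + 1)!`. Two of the `M`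
  -- factors `u / N` absorb these; the remaining `M - 2` are at most `1 / 2`.
  have hch1 : (N.choose t : ℝ) ≤ N ^ (u + 1) / (u + 1).factorial := by
    rw [← Nat.choose_symm htN, ← hu]
    refine (Nat.choose_le_pow_div u N).trans ?_
    rw [Nat.factorial_succ, div_le_div_iff₀ (by positivity) (by positivity), Nat.cast_mul, pow_succ]
    have : ((u + 1 : ℕ) : ℝ) ≤ N := by exact_mod_cast (by omega : u + 1 ≤ N)
    calc (N : ℝ) ^ u * ((u + 1 : ℕ) * u.factorial) ≤ N ^ u * (N * u.factorial) := by gcongr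
      _ = _ := by ring
  have hch2 : (N.choose (t - 1) : ℝ) ≤ N ^ (u + 1) / (u + 1).factorial := by
    rw [← Nat.choose_symm (by omega : t - 1 ≤ N), hs]
    exact Nat.choose_le_pow_div (u + 1) N
  have hexp : (u : ℝ) ^ (u + 1) / (u + 1).factorial ≤ Real.exp 1 ^ (u + 1) := by
    refine (Real.pow_div_factorial_le_exp _ (Nat.cast_nonneg u) (u + 1)).trans ?_
    rw [← Real.exp_nat_mul, Real.exp_le_exp]
    push_cast
    linarith
  have hhalf : (u : ℝ) / N ≤ 1 / 2 := by
    rw [div_le_div_iff₀ hN0 (by norm_num)]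
    exact_mod_cast (by omega : u * 2 ≤ 1 * N)
  have hcp : c ^ (t - 1) ≤ 1 := pow_le_one₀ hc0 hc1
  calc (N.choose t : ℝ) * N.choose (t - 1) * (((u / N : ℝ) ^ (m + 2)) ^ (u + 1) * c ^ (t - 1))
      ≤ (N ^ (u + 1) / (u + 1).factorial) * (N ^ (u + 1) / (u + 1).factorial) *
        (((u / N : ℝ) ^ (m + 2)) ^ (u + 1) * 1) := by gcongr
    _ = ((u : ℝ) ^ (u + 1) / (u + 1).factorial) ^ 2 * ((u / N : ℝ) ^ m) ^ (u + 1) := by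
        simp only [div_pow, ← pow_mul]
        field_simp
        ring
    _ ≤ (Real.exp 1 ^ (u + 1)) ^ 2 * ((1 / 2) ^ m) ^ (u + 1) := by gcongr
    _ = _ := by
        rw [mul_pow, ← pow_mul, ← pow_mul, ← pow_mul, mul_comm (u + 1) 2]

lemma sum_range_pow_succ_le {r : ℝ} (h0 : 0 ≤ r) (h : r ≤ 1 / 2) (n : ℕ) :
    ∑ j ∈ Finset.range n, r ^ (j + 1) ≤ 2 * r := by
  have h1 := mul_neg_geom_sum r n
  have h2 : 0 ≤ r ^ n := pow_nonneg h0 n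
  have h3 : ∑ j ∈ Finset.range n, r ^ j ≤ 2 := by
    have h4 : 0 ≤ ∑ j ∈ Finset.range n, r ^ j := Finset.sum_nonneg fun j _ => pow_nonneg h0 j
    nlinarith
  simp only [pow_succ]
  rw [← Finset.sum_mul]
  nlinarith

variable {Ω : Type*} [MeasurableSpace Ω] {μ : Measure Ω} [IsProbabilityMeasure μ]
  {M : ℕ} {X : Fin N → Ω → Fin N → ℝ} {ρ : Fin N → Measure ℝ}
  [∀ n, IsProbabilityMeasure (ρ n)]

/-- The random bipartite graph in which every user is joined to her `M` best channels has a perfect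
matching with high probability. -/
lemma measureReal_not_exists_injective_le [∀ n, NullSingletonClass (ρ n)] (hX : iIndepFun X μ)
    (hlaw : ∀ n, HasLaw (X n) (Measure.pi fun _ => ρ n) μ) (hM2 : 2 ≤ M) (hM : M ≤ N) {r q : ℝ}
    (hr : r = Real.exp 1 ^ 2 * M *
      (Real.exp 1 * N * Real.exp (-M) + M * Real.exp (-(M / 2)))) (hr2 : r ≤ 1 / 2)
    (hq : q = Real.exp 1 ^ 2 * (1 / 2) ^ (M - 2)) (hq2 : q ≤ 1 / 2) :
    μ.real {ω | ¬ ∃ a : Fin N → Fin N, Function.Injective a ∧ ∀ n, a n ∈ topSet M (X n ω)} ≤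
      2 * r + 2 * q := by
  have hr0 : 0 ≤ r := by rw [hr]; positivity
  have hq0 : 0 ≤ q := by rw [hq]; positivity
  -- Union bound over Hall violators, with `j` users and `j + 1` channels.
  have hsub : {ω | ¬ ∃ a : Fin N → Fin N, Function.Injective a ∧ ∀ n, a n ∈ topSet M (X n ω)} ⊆
      ⋃ j ∈ Finset.range N, ⋃ F ∈ Finset.powersetCard (j + 1) (Finset.univ : Finset (Fin N)),
        ⋃ U ∈ Finset.powersetCard j (Finset.univ : Finset (Fin N)),
          {ω | ∀ n, Disjoint (topSet M (X n ω)) F ↔ n ∉ U} := by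
    intro ω hω
    obtain ⟨F, U, hFU, h⟩ :=
      (exists_injective_or_exists_violator fun n => topSet M (X n ω)).resolve_left hω
    simp only [Set.mem_iUnion]
    have hF : F.card ≤ N := by simpa using Finset.card_le_univ F
    exact ⟨U.card, Finset.mem_range.2 (by omega), F, by simp [Finset.mem_powersetCard, hFU], U,
      by simp [Finset.mem_powersetCard], h⟩
  have hterm : ∀ j ∈ Finset.range N, μ.real
      (⋃ F ∈ Finset.powersetCard (j + 1) (Finset.univ : Finset (Fin N)),
        ⋃ U ∈ Finset.powersetCard j (Finset.univ : Finset (Fin N)),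
          {ω | ∀ n, Disjoint (topSet M (X n ω)) F ↔ n ∉ U}) ≤ r ^ (j + 1) + q ^ (N - 1 - j + 1) := by
    intro j hj
    have hjN : j < N := Finset.mem_range.1 hj
    have hle : μ.real (⋃ F ∈ Finset.powersetCard (j + 1) (Finset.univ : Finset (Fin N)),
        ⋃ U ∈ Finset.powersetCard j (Finset.univ : Finset (Fin N)),
          {ω | ∀ n, Disjoint (topSet M (X n ω)) F ↔ n ∉ U}) ≤
        (N.choose (j + 1) : ℝ) * N.choose j * (((1 - ((j + 1 : ℕ) : ℝ) / N) ^ M) ^ (N - j) *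
          (min (1 : ℝ) (((j + 1 : ℕ) : ℝ) * (M / N))) ^ j) := by
      refine (measureReal_biUnion_finset_le _ _).trans ?_
      refine (Finset.sum_le_sum fun F hF => (measureReal_biUnion_finset_le _ _).trans
        (Finset.sum_le_sum fun U hU => ?_)).trans_eq (b := ∑ F ∈ Finset.powersetCard (j + 1)
          (Finset.univ : Finset (Fin N)), ∑ U ∈ Finset.powersetCard j
          (Finset.univ : Finset (Fin N)), (((1 - ((j + 1 : ℕ) : ℝ) / N) ^ M) ^ (N - j) *
          (min (1 : ℝ) (((j + 1 : ℕ) : ℝ) * (M / N))) ^ j)) ?_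
      · have hFc := (Finset.mem_powersetCard.1 hF).2
        have hUc := (Finset.mem_powersetCard.1 hU).2
        have := measureReal_forall_disjoint_iff_le hX hlaw (by omega) hM U F
        rwa [hFc, hUc] at this
      · simp only [Finset.sum_const, Finset.card_powersetCard, Finset.card_univ, Fintype.card_fin,
          nsmul_eq_mul]
        ring
    refine hle.trans ?_
    by_cases h2 : 2 * (j + 1) ≤ N
    · have := choose_mul_choose_mul_le_of_two_mul_le (N := N) (M := M) (t := j + 1) (by omega)
        (by omega) h2
      rw [← hr, Nat.add_sub_cancel] at this
      exact this.trans (le_add_of_nonneg_right (by positivity))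
    · have := choose_mul_choose_mul_le_of_lt_two_mul (N := N) (M := M) (t := j + 1) hM2
        (by omega) (by omega) (by omega) (c := min (1 : ℝ) (((j + 1 : ℕ) : ℝ) * (M / N)))
        (le_min zero_le_one (by positivity)) (min_le_left _ _)
      rw [← hq, Nat.add_sub_cancel] at this
      rw [show N - 1 - j + 1 = N - j by omega]
      exact this.trans (le_add_of_nonneg_left (by positivity))
  calc _ ≤ _ := measureReal_mono hsub (measure_ne_top _ _)
    _ ≤ _ := measureReal_biUnion_finset_le _ _
    _ ≤ ∑ j ∈ Finset.range N, (r ^ (j + 1) + q ^ (N - 1 - j + 1)) := Finset.sum_le_sum hterm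
    _ = ∑ j ∈ Finset.range N, r ^ (j + 1) + ∑ j ∈ Finset.range N, q ^ (j + 1) := by
        rw [Finset.sum_add_distrib, Finset.sum_range_reflect (fun j => q ^ (j + 1)) N]
    _ ≤ 2 * r + 2 * q :=
        add_le_add (sum_range_pow_succ_le hr0 hr2 N) (sum_range_pow_succ_le hq0 hq2 N)

/-- With high probability there are no large sets of users and channels without an edge between
them. -/
lemma measureReal_exists_disjoint_le (hX : iIndepFun X μ)
    (hlaw : ∀ n, HasLaw (X n) (Measure.pi fun _ => ρ n) μ) (h1 : 1 ≤ M) (hM : M ≤ N) {η : ℝ}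
    (hη : 0 < η) :
    μ.real {ω | ∃ U F : Finset (Fin N), η * N ≤ U.card ∧ η / 2 * N ≤ F.card ∧
      ∀ n ∈ U, Disjoint (topSet M (X n ω)) F} ≤ (4 * Real.exp (-(M * (η / 2 * η)))) ^ N := by
  classical
  have hN : (0 : ℝ) < N := by exact_mod_cast (by omega : 0 < N)
  let s : Finset (Finset (Fin N) × Finset (Fin N)) :=
    Finset.univ.filter fun p => η * N ≤ p.1.card ∧ η / 2 * N ≤ p.2.card
  have hsub : {ω | ∃ U F : Finset (Fin N), η * N ≤ U.card ∧ η / 2 * N ≤ F.card ∧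
      ∀ n ∈ U, Disjoint (topSet M (X n ω)) F} ⊆
      ⋃ p ∈ s, {ω | ∀ n ∈ p.1, Disjoint (topSet M (X n ω)) p.2} := by
    rintro ω ⟨U, F, hU, hF, h⟩
    simp only [Set.mem_iUnion]
    exact ⟨(U, F), by simp [s, hU, hF], h⟩
  have hterm : ∀ p ∈ s, μ.real {ω | ∀ n ∈ p.1, Disjoint (topSet M (X n ω)) p.2} ≤
      Real.exp (-(M * (η / 2 * η))) ^ N := by
    intro p hp
    obtain ⟨hU, hF⟩ : η * N ≤ p.1.card ∧ η / 2 * N ≤ p.2.card := by simpa [s] using hp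
    refine (measureReal_forall_disjoint_le hX hlaw h1 hM p.1 p.2).trans ?_
    have hF' : η / 2 ≤ (p.2.card : ℝ) / N := (le_div_iff₀ hN).2 hF
    have hF1 : (p.2.card : ℝ) / N ≤ 1 :=
      (div_le_one hN).2 (by exact_mod_cast (by simpa using Finset.card_le_univ p.2))
    have hbase : 1 - (p.2.card : ℝ) / N ≤ Real.exp (-(η / 2)) := by
      linarith [Real.add_one_le_exp (-(η / 2))]
    have h0 : 0 ≤ 1 - (p.2.card : ℝ) / N := by linarith
    calc ((1 - (p.2.card : ℝ) / N) ^ M) ^ p.1.card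
        ≤ (Real.exp (-(η / 2)) ^ M) ^ p.1.card := by gcongr
      _ = Real.exp (-(p.1.card * (M * (η / 2)))) := by
          rw [← Real.exp_nat_mul, ← Real.exp_nat_mul]
          ring_nf
      _ ≤ Real.exp (-(η * N * (M * (η / 2)))) := by gcongr
      _ = Real.exp (-(M * (η / 2 * η))) ^ N := by
          rw [← Real.exp_nat_mul]
          ring_nf
  -- There are at most `2 ^ N * 2 ^ N` pairs, a purely exponential number; the bound for each decays
  -- superexponentially in `N` once `M` tends to infinity.
  have hcard : (s.card : ℝ) ≤ 4 ^ N := by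
    have : s.card ≤ 4 ^ N := (Finset.card_le_univ s).trans_eq (by
      simp only [Fintype.card_prod, Fintype.card_finset, Fintype.card_fin]
      rw [← mul_pow]
      norm_num)
    exact_mod_cast this
  calc _ ≤ _ := measureReal_mono hsub (measure_ne_top _ _)
    _ ≤ _ := measureReal_biUnion_finset_le _ _
    _ ≤ s.card • (Real.exp (-(M * (η / 2 * η))) ^ N) := Finset.sum_le_card_nsmul _ _ _ hterm
    _ ≤ 4 ^ N * Real.exp (-(M * (η / 2 * η))) ^ N := by
        rw [nsmul_eq_mul]
        gcongr
    _ = _ := by rw [mul_pow]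

end Hall

/-! ### The Rayleigh tail. -/

section Rayleigh

instance nullSingletonClass_rayleighMeasure (σ : ℝ) : NullSingletonClass (rayleighMeasure σ) := by
  unfold rayleighMeasure
  infer_instance

lemma rayleighMeasure_Ioi {σ : ℝ} (hσ : 0 < σ) {x : ℝ} (hx : 0 ≤ x) :
    (rayleighMeasure σ).real (Set.Ioi x) = Real.exp (-x ^ 2 / (2 * σ ^ 2)) := by
  have hderiv : ∀ y ∈ Set.Ici x, HasDerivAt (fun y => -Real.exp (-y ^ 2 / (2 * σ ^ 2)))
      (y / σ ^ 2 * Real.exp (-y ^ 2 / (2 * σ ^ 2))) y := by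
    intro y _
    have h1 : HasDerivAt (fun y : ℝ => -y ^ 2 / (2 * σ ^ 2)) (-(2 * y) / (2 * σ ^ 2)) y := by
      have := ((hasDerivAt_pow 2 y).neg).div_const (2 * σ ^ 2)
      simpa using this
    have h2 := h1.exp.neg
    rw [neg_div (2 * σ ^ 2) (2 * y), mul_div_mul_left _ _ two_ne_zero, mul_neg, neg_neg,
      mul_comm (Real.exp _)] at h2
    exact h2
  have hnonneg : ∀ y ∈ Set.Ioi x, 0 ≤ y / σ ^ 2 * Real.exp (-y ^ 2 / (2 * σ ^ 2)) := by
    intro y hy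
    have : 0 ≤ y := hx.trans (le_of_lt hy)
    positivity
  have hlim : Tendsto (fun y : ℝ => -Real.exp (-y ^ 2 / (2 * σ ^ 2))) atTop (𝓝 0) := by
    rw [← neg_zero]
    refine (Real.tendsto_exp_atBot.comp ?_).neg
    refine Tendsto.atBot_div_const (by positivity) ?_
    exact tendsto_neg_atTop_atBot.comp (tendsto_pow_atTop two_ne_zero)
  have hint := integral_Ioi_of_hasDerivAt_of_nonneg' hderiv hnonneg hlim
  have hintegrable := integrableOn_Ioi_deriv_of_nonneg' hderiv hnonneg hlim
  have hl : rayleighMeasure σ (Set.Ioi x) =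
      ENNReal.ofReal (Real.exp (-x ^ 2 / (2 * σ ^ 2))) := by
    rw [rayleighMeasure, withDensity_apply _ measurableSet_Ioi]
    rw [setLIntegral_congr_fun measurableSet_Ioi (g := fun y =>
      ENNReal.ofReal (y / σ ^ 2 * Real.exp (-y ^ 2 / (2 * σ ^ 2)))) (fun y hy => by
        simp only
        rw [if_pos (hx.trans (le_of_lt hy))])]
    rw [← ofReal_integral_eq_lintegral_ofReal hintegrable
      ((ae_restrict_iff' measurableSet_Ioi).2 (ae_of_all _ hnonneg)), hint]
    simp
  rw [Measure.real, hl, ENNReal.toReal_ofReal (Real.exp_nonneg _)]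

end Rayleigh

/-! ### Uniform bounds for the `M`-th best and the best gains. -/

section OrderStatTails

variable {N M : ℕ}

/-- It is unlikely that fewer than `M` of `N` independent variables reach a level that each of them
reaches with probability at least `p`. -/
lemma pi_real_card_lt_le (ρ : Measure ℝ) [IsProbabilityMeasure ρ] (h1 : 1 ≤ M) (hM : M ≤ N)
    {y p : ℝ} (hp : ρ.real (Set.Iio y) ≤ 1 - p) :
    (Measure.pi fun _ : Fin N => ρ).real {x | Finset.card {k | y ≤ x k} < M} ≤
      N ^ (M - 1) * Real.exp (-(p * (N - M + 1))) := by
  -- If fewer than `M` entries reach `y`, some `N - (M - 1)` entries all stay below it.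
  have hsub : {x : Fin N → ℝ | Finset.card {k | y ≤ x k} < M} ⊆
      ⋃ A ∈ Finset.powersetCard (N - (M - 1)) (Finset.univ : Finset (Fin N)),
        {x : Fin N → ℝ | ∀ k ∈ A, x k < y} := by
    intro x hx
    have hc := Finset.card_filter_add_card_filter_not (s := (Finset.univ : Finset (Fin N)))
      (fun k => y ≤ x k)
    rw [Finset.card_univ, Fintype.card_fin] at hc
    have hx' : Finset.card {k | y ≤ x k} < M := hx
    obtain ⟨A, hA, hAc⟩ := Finset.exists_subset_card_eq
      (show N - (M - 1) ≤ Finset.card {k | ¬ y ≤ x k} by omega)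
    simp only [Set.mem_iUnion]
    refine ⟨A, by simp [Finset.mem_powersetCard, hAc], fun k hk => ?_⟩
    simpa using hA hk
  have hbox : ∀ A ∈ Finset.powersetCard (N - (M - 1)) (Finset.univ : Finset (Fin N)),
      (Measure.pi fun _ : Fin N => ρ).real {x : Fin N → ℝ | ∀ k ∈ A, x k < y} ≤
        Real.exp (-(p * (N - M + 1))) := by
    intro A hA
    have hAc := (Finset.mem_powersetCard.1 hA).2
    have heq : {x : Fin N → ℝ | ∀ k ∈ A, x k < y} =
        Set.pi Set.univ fun k => if k ∈ A then Set.Iio y else Set.univ := by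
      ext x
      simp only [Set.mem_ofPred_eq, Set.mem_pi, Set.mem_univ, true_implies]
      refine forall_congr' fun k => ?_
      by_cases hk : k ∈ A <;> simp [hk]
    rw [heq, Measure.real, Measure.pi_pi, ENNReal.toReal_prod]
    have hfac : ∀ k : Fin N, (ρ (if k ∈ A then Set.Iio y else Set.univ)).toReal =
        if k ∈ A then ρ.real (Set.Iio y) else 1 := by
      intro k
      by_cases hk : k ∈ A <;> simp [hk, Measure.real]
    rw [Finset.prod_congr rfl fun k _ => hfac k, Finset.prod_ite, Finset.prod_const,
      Finset.prod_const_one, mul_one]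
    have hc1 : Finset.filter (fun n => n ∈ A) Finset.univ = A := by ext; simp
    rw [hc1, hAc]
    have hle : ρ.real (Set.Iio y) ≤ Real.exp (-p) := by linarith [Real.add_one_le_exp (-p)]
    calc ρ.real (Set.Iio y) ^ (N - (M - 1)) ≤ Real.exp (-p) ^ (N - (M - 1)) := by gcongr
      _ = _ := by
        rw [← Real.exp_nat_mul, Nat.cast_sub (by omega), Nat.cast_sub h1]
        congr 1
        push_cast
        ring
  calc _ ≤ _ := measureReal_mono hsub (measure_ne_top _ _)
    _ ≤ _ := measureReal_biUnion_finset_le _ _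
    _ ≤ _ := Finset.sum_le_card_nsmul _ _ _ hbox
    _ ≤ _ := by
      rw [Finset.card_powersetCard, Finset.card_univ, Fintype.card_fin, nsmul_eq_mul,
        Nat.choose_symm (by omega)]
      gcongr
      exact_mod_cast Nat.choose_le_pow N (M - 1)

variable {Ω : Type*} [MeasurableSpace Ω] {μ : Measure Ω} {X : Fin N → Ω → Fin N → ℝ} {σ : Fin N → ℝ}

lemma measureReal_exists_card_lt_le [∀ n, IsProbabilityMeasure (rayleighMeasure (σ n))]
    (hσ : ∀ n, 0 < σ n)
    (hlaw : ∀ n, HasLaw (X n) (Measure.pi fun _ => rayleighMeasure (σ n)) μ)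
    (h1 : 1 ≤ M) (hM : M ≤ N) {v : ℝ} (hv : 0 ≤ v) :
    μ.real {ω | ∃ n, Finset.card {k | σ n * √(2 * v) ≤ X n ω k} < M} ≤
      N ^ M * Real.exp (-(Real.exp (-v) * (N - M + 1))) := by
  have hsub : {ω | ∃ n, Finset.card {k | σ n * √(2 * v) ≤ X n ω k} < M} =
      ⋃ n ∈ (Finset.univ : Finset (Fin N)),
        X n ⁻¹' {x | Finset.card {k | σ n * √(2 * v) ≤ x k} < M} := by
    ext ω; simp
  have hterm : ∀ n ∈ (Finset.univ : Finset (Fin N)),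
      μ.real (X n ⁻¹' {x | Finset.card {k | σ n * √(2 * v) ≤ x k} < M}) ≤
        N ^ (M - 1) * Real.exp (-(Real.exp (-v) * (N - M + 1))) := by
    intro n _
    have hms : MeasurableSet {x : Fin N → ℝ | Finset.card {k | σ n * √(2 * v) ≤ x k} < M} := by
      simp only [Finset.card_filter]
      refine measurableSet_lt (Finset.measurable_sum _ fun k _ => ?_) measurable_const
      exact Measurable.ite (measurableSet_le measurable_const (measurable_pi_apply k))
        measurable_const measurable_const
    rw [measureReal_preimage_of_hasLaw (hlaw n) hms]
    refine pi_real_card_lt_le _ h1 hM ?_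
    have hs := hσ n
    have hx : 0 ≤ σ n * √(2 * v) := by positivity
    have htail := rayleighMeasure_Ioi hs hx
    -- The level is normalised so that a Rayleigh variable exceeds it with probability `exp (-v)`,
    -- whatever its scale.
    have hexp : -(σ n * √(2 * v)) ^ 2 / (2 * σ n ^ 2) = -v := by
      rw [mul_pow, Real.sq_sqrt (by positivity)]
      field_simp
    rw [hexp] at htail
    rw [← htail, ← probReal_compl_eq_one_sub measurableSet_Ioi]
    refine measureReal_mono (fun z hz => ?_) (measure_ne_top _ _)
    simpa using le_of_lt (Set.mem_Iio.1 hz)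
  rw [hsub]
  refine (measureReal_biUnion_finset_le _ _).trans ((Finset.sum_le_sum hterm).trans_eq ?_)
  rw [Finset.sum_const, Finset.card_univ, Fintype.card_fin, nsmul_eq_mul, ← mul_assoc,
    ← pow_succ', Nat.sub_add_cancel h1]

lemma measureReal_exists_lt_le (hσ : ∀ n, 0 < σ n)
    (hlaw : ∀ n k, HasLaw (fun ω => X n ω k) (rayleighMeasure (σ n)) μ) {v : ℝ} (hv : 0 ≤ v) :
    μ.real {ω | ∃ n k, σ n * √(2 * v) < X n ω k} ≤ N ^ 2 * Real.exp (-v) := by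
  have hsub : {ω | ∃ n k, σ n * √(2 * v) < X n ω k} =
      ⋃ p ∈ (Finset.univ : Finset (Fin N × Fin N)),
        (fun ω => X p.1 ω p.2) ⁻¹' Set.Ioi (σ p.1 * √(2 * v)) := by
    ext ω; simp
  have hterm : ∀ p ∈ (Finset.univ : Finset (Fin N × Fin N)),
      μ.real ((fun ω => X p.1 ω p.2) ⁻¹' Set.Ioi (σ p.1 * √(2 * v))) ≤ Real.exp (-v) := by
    intro p _
    have hs := hσ p.1
    rw [measureReal_preimage_of_hasLaw (hlaw p.1 p.2) measurableSet_Ioi,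
      rayleighMeasure_Ioi hs (by positivity), mul_pow, Real.sq_sqrt (by positivity)]
    refine (congrArg Real.exp ?_).le
    field_simp
  rw [hsub]
  refine (measureReal_biUnion_finset_le _ _).trans ((Finset.sum_le_sum hterm).trans_eq ?_)
  rw [Finset.sum_const, Finset.card_univ, Fintype.card_prod, Fintype.card_fin, nsmul_eq_mul]
  push_cast
  ring

end OrderStatTails

/-! ### Limits of the error bounds. -/

section Asymptotics

variable {ε : ℝ} {M : ℕ → ℕ}

lemma tendsto_log_natCast_atTop : Tendsto (fun N : ℕ => Real.log N) atTop atTop :=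
  Real.tendsto_log_atTop.comp tendsto_natCast_atTop_atTop

lemma tendsto_natCast_atTop_of_abs_sub_log_lt (hε : 0 < ε)
    (hM : ∀ N, |(M N : ℝ) - (1 + ε) * Real.log N| < 1) :
    Tendsto (fun N => (M N : ℝ)) atTop atTop := by
  have h : Tendsto (fun N : ℕ => (1 + ε) * Real.log N - 1) atTop atTop :=
    tendsto_atTop_add_const_right _ _
      (tendsto_log_natCast_atTop.const_mul_atTop (by linarith))
  refine tendsto_atTop_mono (fun N => ?_) h
  linarith [(abs_lt.1 (hM N)).1]

lemma tendsto_pow_mul_exp_neg_mul (k : ℕ) {c : ℝ} (hc : 0 < c) :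
    Tendsto (fun x : ℝ => x ^ k * Real.exp (-(c * x))) atTop (𝓝 0) := by
  have h := (Real.tendsto_pow_mul_exp_neg_atTop_nhds_zero k).comp (tendsto_id.const_mul_atTop hc)
  have h2 := h.const_mul ((c ^ k)⁻¹)
  rw [mul_zero] at h2
  refine h2.congr fun x => ?_
  simp only [Function.comp_apply, id_eq, mul_pow]
  field_simp

lemma tendsto_matching_bound (hε : 0 < ε)
    (hM : ∀ N, |(M N : ℝ) - (1 + ε) * Real.log N| < 1) :
    Tendsto (fun N => Real.exp 1 ^ 2 * M N *
      (Real.exp 1 * N * Real.exp (-M N) + M N * Real.exp (-(M N / 2)))) atTop (𝓝 0) := by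
  have hMt := tendsto_natCast_atTop_of_abs_sub_log_lt hε hM
  have hc : 0 < ε / (1 + ε) := by positivity
  have h1 := (((tendsto_pow_mul_exp_neg_mul 1 hc).comp hMt).const_mul
    (Real.exp 1 ^ 3 * Real.exp (1 / (1 + ε)))).add
    (((tendsto_pow_mul_exp_neg_mul 2 (show (0 : ℝ) < 1 / 2 by norm_num)).comp hMt).const_mul
      (Real.exp 1 ^ 2))
  rw [mul_zero, mul_zero, add_zero] at h1
  refine squeeze_zero' (Eventually.of_forall fun N => by positivity) ?_ h1
  filter_upwards [eventually_gt_atTop 0] with N hN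
  simp only [Function.comp_apply, pow_one]
  have hN0 : (0 : ℝ) < N := by exact_mod_cast hN
  -- Here the margin `ε` is spent: `log N ≤ (M + 1) / (1 + ε)` makes `N * exp (-M)` exponentially
  -- small in `M`, which beats the remaining factor `M`.
  have hle : N * Real.exp (-(M N : ℝ)) ≤
      Real.exp (1 / (1 + ε)) * Real.exp (-(ε / (1 + ε) * M N)) := by
    nth_rewrite 1 [← Real.exp_log hN0]
    rw [← Real.exp_add, ← Real.exp_add, Real.exp_le_exp]
    have h := (abs_lt.1 (hM N)).1
    have h2 : Real.log N ≤ (M N + 1) / (1 + ε) := by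
      rw [le_div_iff₀ (by linarith)]
      linarith
    have h3 : (M N + 1) / (1 + ε) + -(M N : ℝ) = 1 / (1 + ε) + -(ε / (1 + ε) * M N) := by
      field_simp
      ring
    linarith
  calc _ = Real.exp 1 ^ 3 * M N * (N * Real.exp (-(M N : ℝ))) +
        Real.exp 1 ^ 2 * (M N ^ 2 * Real.exp (-(1 / 2 * M N))) := by
        rw [show (M N : ℝ) / 2 = 1 / 2 * M N by ring]
        ring
    _ ≤ Real.exp 1 ^ 3 * M N *
        (Real.exp (1 / (1 + ε)) * Real.exp (-(ε / (1 + ε) * M N))) +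
        Real.exp 1 ^ 2 * (M N ^ 2 * Real.exp (-(1 / 2 * M N))) := by gcongr
    _ = _ := by ring

lemma tendsto_atTop_of_abs_sub_log_lt (hε : 0 < ε)
    (hM : ∀ N, |(M N : ℝ) - (1 + ε) * Real.log N| < 1) : Tendsto M atTop atTop :=
  tendsto_natCast_atTop_iff.1 (tendsto_natCast_atTop_of_abs_sub_log_lt hε hM)

lemma tendsto_const_mul_half_pow (hMt : Tendsto M atTop atTop) :
    Tendsto (fun N => Real.exp 1 ^ 2 * (1 / 2 : ℝ) ^ (M N - 2)) atTop (𝓝 0) := by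
  have h := ((tendsto_pow_atTop_nhds_zero_of_lt_one (r := (1 / 2 : ℝ)) (by norm_num)
    (by norm_num)).comp ((tendsto_sub_atTop_nat 2).comp hMt)).const_mul (Real.exp 1 ^ 2)
  rw [mul_zero] at h
  exact h

lemma tendsto_mul_exp_neg_pow (hMt : Tendsto (fun N => (M N : ℝ)) atTop atTop) {c : ℝ}
    (hc : 0 < c) : Tendsto (fun N => (4 * Real.exp (-(M N * c))) ^ N) atTop (𝓝 0) := by
  have h0 : Tendsto (fun N => 4 * Real.exp (-(M N * c))) atTop (𝓝 0) := by
    have := (Real.tendsto_exp_neg_atTop_nhds_zero.comp (hMt.atTop_mul_const hc)).const_mul 4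
    rw [mul_zero] at this
    exact this
  refine squeeze_zero' (Eventually.of_forall fun N => by positivity) ?_
    (tendsto_pow_atTop_nhds_zero_of_lt_one (r := (1 / 2 : ℝ)) (by norm_num) (by norm_num))
  filter_upwards [h0.eventually_le_const (show (0 : ℝ) < 1 / 2 by norm_num)] with N hN
  gcongr

lemma eventually_quadratic_log_le (hε : 0 < ε) :
    ∀ᶠ N : ℕ in atTop, ((1 + ε) * Real.log N + 1) * Real.log N + Real.log N + 1 ≤ √N ∧
      (1 + ε) * Real.log N + 1 ≤ √N := by
  filter_upwards [tendsto_log_natCast_atTop.eventually_ge_atTop (48 * (5 + ε)),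
    eventually_gt_atTop 0] with N hL hN
  have hN0 : (0 : ℝ) < N := by exact_mod_cast hN
  set L := Real.log N with hLdef
  have hexp : √(N : ℝ) = Real.exp (L / 2) := by
    rw [hLdef, Real.exp_half, Real.exp_log hN0]
  -- A cubic term of the exponential gives `√N ≥ L ^ 3 / 48`; hence the constant `48` in the
  -- threshold for `L`.
  have h3 : (L / 2) ^ 3 / 6 ≤ Real.exp (L / 2) := by
    have := Real.pow_div_factorial_le_exp (L / 2) (by linarith) 3
    simpa [Nat.factorial] using this
  have hL1 : 1 ≤ L := by linarith
  have h4 : (5 + ε) * L ^ 2 ≤ (L / 2) ^ 3 / 6 := by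
    have : 48 * (5 + ε) * L ^ 2 ≤ L * L ^ 2 := by gcongr
    nlinarith
  have h5 : L ≤ L ^ 2 := by nlinarith
  rw [hexp]
  constructor <;> nlinarith

lemma eventually_le_of_abs_sub_log_lt (hε : 0 < ε)
    (hM : ∀ N, |(M N : ℝ) - (1 + ε) * Real.log N| < 1) :
    ∀ᶠ N in atTop, M N ≤ N ∧ (M N : ℝ) ≤ √N := by
  filter_upwards [eventually_quadratic_log_le hε, eventually_gt_atTop 0] with N h hN
  have h1 : (M N : ℝ) ≤ √N := by linarith [(abs_lt.1 (hM N)).2, h.2]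
  refine ⟨?_, h1⟩
  have h2 : √(N : ℝ) ≤ N := Real.sqrt_le_self_iff.2 (Or.inr (by exact_mod_cast hN))
  exact_mod_cast h1.trans h2

lemma tendsto_pow_mul_exp_neg_sqrt (hε : 0 < ε)
    (hM : ∀ N, |(M N : ℝ) - (1 + ε) * Real.log N| < 1) :
    Tendsto (fun N : ℕ => (N : ℝ) ^ M N *
      Real.exp (-(Real.exp (-(Real.log N / 2)) * (N - M N + 1)))) atTop (𝓝 0) := by
  refine squeeze_zero' (Eventually.of_forall fun N => by positivity) ?_
    (Real.tendsto_exp_neg_atTop_nhds_zero.comp tendsto_log_natCast_atTop)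
  filter_upwards [eventually_quadratic_log_le hε, eventually_le_of_abs_sub_log_lt hε hM,
    eventually_gt_atTop 0] with N h1 h2 hN
  have hN0 : (0 : ℝ) < N := by exact_mod_cast hN
  have hL : 0 ≤ Real.log N := Real.log_natCast_nonneg N
  have hs : 0 < √(N : ℝ) := Real.sqrt_pos.2 hN0
  have hexp : Real.exp (-(Real.log N / 2)) = (√(N : ℝ))⁻¹ := by
    rw [Real.exp_neg, Real.exp_half, Real.exp_log hN0]
  have hpow : (N : ℝ) ^ M N = Real.exp (M N * Real.log N) := by
    rw [Real.exp_nat_mul, Real.exp_log hN0]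
  simp only [Function.comp_apply]
  rw [hpow, hexp, ← Real.exp_add, Real.exp_le_exp]
  -- The second exponent is at least `√N - 1` because `M ≤ √N`; it dominates `M * log N`, which is
  -- of order `(log N) ^ 2`.
  have h3 : √(N : ℝ) - 1 ≤ (√(N : ℝ))⁻¹ * (N - M N + 1) := by
    rw [inv_mul_eq_div, le_div_iff₀ hs, sub_mul, Real.mul_self_sqrt hN0.le]
    linarith [h2.2]
  have h4 : (M N : ℝ) * Real.log N ≤ ((1 + ε) * Real.log N + 1) * Real.log N := by
    gcongr
    linarith [(abs_lt.1 (hM N)).2]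
  linarith [h1.1]

lemma tendsto_log_one_add_mul_div_log {c : ℝ} (hc : 0 < c) :
    Tendsto (fun x : ℝ => Real.log (1 + c * x) / Real.log x) atTop (𝓝 1) := by
  have h1 : Tendsto (fun x : ℝ => Real.log (x⁻¹ + c)) atTop (𝓝 (Real.log (0 + c))) :=
    (tendsto_inv_atTop_zero.add_const c).log (by linarith)
  have h2 := (h1.div_atTop Real.tendsto_log_atTop).const_add 1
  rw [add_zero] at h2
  refine h2.congr' ?_
  filter_upwards [eventually_gt_atTop 1] with x hx
  have hx0 : 0 < x := by linarith
  have hl : Real.log x ≠ 0 := (Real.log_pos hx).ne'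
  have : 1 + c * x = x * (x⁻¹ + c) := by field_simp
  rw [this, Real.log_mul hx0.ne' (by positivity)]
  field_simp

/-- Constant factors before `log N` change its logarithm only by a bounded amount, so the gap
between the best and `M`-th best gains disappears from the ratio of rates. -/
lemma tendsto_logb_div_logb {c d : ℝ} (hc : 0 < c) (hd : 0 < d) :
    Tendsto (fun N : ℕ => Real.logb 2 (1 + c * Real.log N) / Real.logb 2 (1 + d * Real.log N))
      atTop (𝓝 1) := by
  have h := ((tendsto_log_one_add_mul_div_log hc).div (tendsto_log_one_add_mul_div_log hd)
    one_ne_zero).comp tendsto_log_natCast_atTop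
  rw [div_one] at h
  refine h.congr' ?_
  filter_upwards [tendsto_log_natCast_atTop.eventually_gt_atTop 1] with N hN
  have h1 : Real.log (Real.log N) ≠ 0 := (Real.log_pos hN).ne'
  simp only [Function.comp_apply, Pi.div_apply, Real.logb]
  rw [div_div_div_cancel_right₀ h1, div_div_div_cancel_right₀ (Real.log_pos one_lt_two).ne']

end Asymptotics

/-! ### The deterministic bound for the ratio. -/

namespace Network

variable {N : ℕ} (S : Network N) {M : ℕ}

/-- Every equilibrium is nearly ideal when few users suffer interference and the rates in the
`M`-th best channels are close to those in the best ones. -/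
lemma mul_idealSumRate_le_weightedSumRate (h1 : 1 ≤ M) (hM : M ≤ N) (hP : ∀ n, 0 < S.power n)
    (hN : 0 < S.noise) {wmin wmax : ℝ} (hwmin : 0 < wmin)
    (hw : ∀ n, wmin ≤ S.weight n ∧ S.weight n ≤ wmax) {L₁ L₂ η : ℝ} (hL₁ : 0 < L₁) (hη : 0 ≤ η)
    (hlow : ∀ n,
      L₁ ≤ Real.logb 2 (1 + S.power n / S.noise * S.orderedGain n (N - M + 1) ^ 2))
    (hupp : ∀ n, Real.logb 2 (1 + S.power n / S.noise * S.orderedGain n N ^ 2) ≤ L₂)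
    (hpos : ∀ n, 0 < S.orderedGain n (N - M + 1))
    {a : Fin N → Fin N} (ha : a ∈ (S.mFSIG M).pneSet)
    (hcrowd : (Finset.card {n | 0 < S.interference a n (a n)} : ℝ) ≤ η * N) :
    0 < S.idealSumRate ∧
      (L₁ / L₂ - η * (wmax / wmin)) * S.idealSumRate ≤ S.weightedSumRate a := by
  have hN0 : 0 < N := by omega
  have hN' : (0 : ℝ) < N := by exact_mod_cast hN0
  have hwmax : 0 < wmax := hwmin.trans_le ((hw ⟨0, hN0⟩).1.trans (hw ⟨0, hN0⟩).2)
  have hbest : ∀ n, L₁ ≤ Real.logb 2 (1 + S.power n / S.noise * S.orderedGain n N ^ 2) := by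
    intro n
    refine (hlow n).trans (Real.logb_le_logb_of_le (by norm_num) ?_ ?_)
    · have := mul_nonneg (div_pos (hP n) hN).le (sq_nonneg (S.orderedGain n (N - M + 1)))
      linarith
    · obtain ⟨k, hk⟩ := exists_orderStat_eq (x := S.directGain n) (i := N - M + 1)
        (by omega) (by omega)
      have hle : S.orderedGain n (N - M + 1) ≤ S.orderedGain n N :=
        hk.le.trans (le_orderStat_self k)
      have h2 := pow_le_pow_left₀ (hpos n).le hle 2
      have h3 := mul_le_mul_of_nonneg_left h2 (div_pos (hP n) hN).le
      linarith
  have hL₂ : 0 < L₂ := hL₁.trans_le ((hbest ⟨0, hN0⟩).trans (hupp ⟨0, hN0⟩))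
  have hidealU : S.idealSumRate ≤ (∑ n, S.weight n) * L₂ := by
    rw [Finset.sum_mul]
    exact Finset.sum_le_sum fun n _ =>
      mul_le_mul_of_nonneg_left (hupp n) (hwmin.le.trans (hw n).1)
  have hidealL : N * (wmin * L₁) ≤ S.idealSumRate := by
    have : ∑ _n : Fin N, wmin * L₁ ≤ S.idealSumRate := Finset.sum_le_sum fun n _ =>
      mul_le_mul (hw n).1 (hbest n) hL₁.le (hwmin.le.trans (hw n).1)
    simpa using this
  have hW := S.le_weightedSumRate_of_mem_pneSet h1 hM hP hN
    (fun n => ⟨hwmin.le.trans (hw n).1, (hw n).2⟩) hL₁ hlow hpos ha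
  refine ⟨lt_of_lt_of_le (by positivity) hidealL, le_trans ?_ hW⟩
  have e1 : L₁ / L₂ * S.idealSumRate ≤ (∑ n, S.weight n) * L₁ := by
    calc L₁ / L₂ * S.idealSumRate ≤ L₁ / L₂ * ((∑ n, S.weight n) * L₂) := by gcongr
      _ = _ := by field_simp
  have e2 : (Finset.card {n | 0 < S.interference a n (a n)} : ℝ) * (wmax * L₁) ≤
      η * (wmax / wmin) * S.idealSumRate := by
    calc (Finset.card {n | 0 < S.interference a n (a n)} : ℝ) * (wmax * L₁)
        ≤ η * N * (wmax * L₁) := by gcongr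
      _ = η * (wmax / wmin) * (N * (wmin * L₁)) := by field_simp
      _ ≤ _ := by gcongr
  rw [sub_mul]
  linarith

end Network

/-! ### Passing from exceptional sets to limits. -/

section Convergence

variable {Ω : Type*} [MeasurableSpace Ω] {μ : Measure Ω} [IsProbabilityMeasure μ]

lemma tendsto_measure_of_eventually_subset {A B : ℕ → Set Ω}
    (hB : Tendsto (fun N => μ.real (B N)) atTop (𝓝 0)) (h : ∀ᶠ N in atTop, A N ⊆ B N) :
    Tendsto (fun N => μ (A N)) atTop (𝓝 0) := by
  have hB' : Tendsto (fun N => μ (B N)) atTop (𝓝 0) :=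
    (ENNReal.tendsto_toReal_iff (fun N => measure_ne_top μ _) ENNReal.zero_ne_top).1 hB
  exact tendsto_of_tendsto_of_tendsto_of_le_of_le' tendsto_const_nhds hB'
    (Eventually.of_forall fun _ => zero_le) (h.mono fun N hN => measure_mono hN)

/-- Subadditivity gives `1 ≤ μ A + μ Aᶜ` even for non-measurable `A`, so measurability of the event
need not be checked. -/
lemma tendsto_measure_one_of_eventually_compl_subset {A B : ℕ → Set Ω}
    (hB : Tendsto (fun N => μ.real (B N)) atTop (𝓝 0)) (h : ∀ᶠ N in atTop, (A N)ᶜ ⊆ B N) :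
    Tendsto (fun N => μ (A N)) atTop (𝓝 1) := by
  have h0 := tendsto_measure_of_eventually_subset hB h
  have h1 : Tendsto (fun N => 1 - μ (A N)ᶜ) atTop (𝓝 (1 - 0)) :=
    ENNReal.Tendsto.sub tendsto_const_nhds h0 (Or.inl ENNReal.one_ne_top)
  rw [tsub_zero] at h1
  refine tendsto_of_tendsto_of_tendsto_of_le_of_le h1 tendsto_const_nhds (fun N => ?_)
    fun N => prob_le_one
  rw [tsub_le_iff_right, ← measure_univ (μ := μ), ← Set.union_compl_self (A N)]
  exact measure_union_le _ _

end Convergence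

/-! ### The exceptional events for the random network. -/

section RandomNetwork

variable {Ω : Type*} [MeasurableSpace Ω] {μ : Measure Ω}

/-- The law of a random variable has total mass one, so the density need not be integrated. -/
lemma isProbabilityMeasure_rayleighMeasure_of_hasLaw [IsProbabilityMeasure μ] {Y : Ω → ℝ} {σ : ℝ}
    (h : HasLaw Y (rayleighMeasure σ) μ) : IsProbabilityMeasure (rayleighMeasure σ) := by
  rw [← h.map_eq]
  exact Measure.isProbabilityMeasure_map h.aemeasurable

lemma iIndepFun_norm_direct {N : ℕ} {h : Fin N → Fin N → Fin N → Ω → ℂ}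
    (h_indep : iIndepFun (fun p : Fin N × Fin N × Fin N => h p.1 p.2.1 p.2.2) μ) :
    iIndepFun (fun p : Fin N × Fin N => fun ω => ‖h p.1 p.1 p.2 ω‖) μ := by
  have h1 := h_indep.precomp (g := fun p : Fin N × Fin N => (p.1, p.1, p.2)) (by
    rintro ⟨a, b⟩ ⟨c, d⟩ hab
    simp only [Prod.mk.injEq] at hab
    simp [hab.1, hab.2.2])
  exact h1.comp (fun _ z => ‖z‖) fun _ => measurable_norm

/-- With high probability the game has an equilibrium, and all its equilibria are nearly ideal. -/
lemma exists_exceptional_sets [IsProbabilityMeasure μ]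
    (h : (N : ℕ) → Fin N → Fin N → Fin N → Ω → ℂ)
    (h_meas : ∀ N m n k, Measurable (h N m n k))
    (h_indep : ∀ N, iIndepFun (fun p : Fin N × Fin N × Fin N => h N p.1 p.2.1 p.2.2) μ)
    (σ : (N : ℕ) → Fin N → ℝ) (hσ : ∀ N n, 0 < σ N n)
    (h_rayleigh : ∀ N n k, HasLaw (fun ω => ‖h N n n k ω‖) (rayleighMeasure (σ N n)) μ)
    (w : (N : ℕ) → Fin N → ℝ) (wmin wmax : ℝ) (hwmin : 0 < wmin)
    (hw : ∀ N n, wmin ≤ w N n ∧ w N n ≤ wmax)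
    (N₀ : ℝ) (hN₀ : 0 < N₀)
    (P : (N : ℕ) → Fin N → ℝ) (hP : ∀ N n, 0 < P N n)
    (snrMin snrMax : ℝ) (hsnrMin : 0 < snrMin)
    (hsnr : ∀ N n, snrMin ≤ P N n * (2 * σ N n ^ 2) / N₀ ∧
      P N n * (2 * σ N n ^ 2) / N₀ ≤ snrMax)
    (ε : ℝ) (hε : 0 < ε) (M : ℕ → ℕ)
    (hM : ∀ N, |(M N : ℝ) - (1 + ε) * Real.log N| < 1)
    (S : (N : ℕ) → Ω → Network N)
    (hS : S = fun N ω =>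
      { gain := fun m n k => h N m n k ω, power := P N, weight := w N, noise := N₀ })
    {δ : ℝ} (hδ : 0 < δ) :
    ∃ B : ℕ → Set Ω, Tendsto (fun N => μ.real (B N)) atTop (𝓝 0) ∧
      ∀ᶠ N in atTop, ∀ ω ∉ B N, ((S N ω).mFSIG (M N)).pneSet.Nonempty ∧
        0 < (S N ω).idealSumRate ∧ ∀ a ∈ ((S N ω).mFSIG (M N)).pneSet,
          (1 - δ) * (S N ω).idealSumRate < (S N ω).weightedSumRate a := by
  have hwmax : 0 < wmax := hwmin.trans_le ((hw 1 0).1.trans (hw 1 0).2)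
  have hsnrMax : 0 < snrMax := hsnrMin.trans_le ((hsnr 1 0).1.trans (hsnr 1 0).2)
  -- The error `δ` is split evenly: `η * (wmax / wmin) = δ / 2` for the interfered users, and `δ /
  -- 2` for the ratio of rates.
  obtain ⟨η, hη_def⟩ : ∃ η, η = δ / 2 * (wmin / wmax) := ⟨_, rfl⟩
  have hη : 0 < η := by rw [hη_def]; positivity
  let X : (N : ℕ) → Fin N → Ω → Fin N → ℝ := fun N n ω k => ‖h N n n k ω‖
  have hprob : ∀ N (n : Fin N), IsProbabilityMeasure (rayleighMeasure (σ N n)) := fun N n =>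
    isProbabilityMeasure_rayleighMeasure_of_hasLaw (h_rayleigh N n n)
  have hind := fun N => iIndepFun_norm_direct (h_indep N)
  have hX : ∀ N, iIndepFun (X N) μ := fun N =>
    iIndepFun_curry (X := fun n k ω => ‖h N n n k ω‖) (fun n k => (h_meas N n n k).norm) (hind N)
  have hlaw : ∀ N n, HasLaw (X N n) (Measure.pi fun _ => rayleighMeasure (σ N n)) μ := by
    intro N n
    have := (hind N).precomp (g := fun k : Fin N => (n, k)) (Prod.mk_right_injective n)
    exact iIndepFun.hasLaw_pi (fun k => h_rayleigh N n k) this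
  let B₁ : ℕ → Set Ω := fun N =>
    {ω | ¬ ∃ a : Fin N → Fin N, Function.Injective a ∧ ∀ n, a n ∈ topSet (M N) (X N n ω)}
  let B₂ : ℕ → Set Ω := fun N => {ω | ∃ U F : Finset (Fin N), η * N ≤ U.card ∧
    η / 2 * N ≤ F.card ∧ ∀ n ∈ U, Disjoint (topSet (M N) (X N n ω)) F}
  -- With `v = log N / 2` each channel reaches the level with probability `N ^ (-1/2)`, so about
  -- `√N` channels do, far more than `M`.
  let B₃ : ℕ → Set Ω := fun N => {ω | ∃ n,
    Finset.card {k | σ N n * √(2 * (Real.log N / 2)) ≤ X N n ω k} < M N}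
  -- With `v = 3 * log N` the union bound over the `N ^ 2` direct gains gives `1 / N`.
  let B₄ : ℕ → Set Ω := fun N => {ω | ∃ n k, σ N n * √(2 * (3 * Real.log N)) < X N n ω k}
  have hMt := tendsto_atTop_of_abs_sub_log_lt hε hM
  have hMle := eventually_le_of_abs_sub_log_lt hε hM
  have hB₁ : Tendsto (fun N => μ.real (B₁ N)) atTop (𝓝 0) := by
    have hr := tendsto_matching_bound hε hM
    have hq := tendsto_const_mul_half_pow hMt
    have hlim := (hr.const_mul 2).add (hq.const_mul 2)
    rw [mul_zero, add_zero] at hlim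
    refine squeeze_zero' (Eventually.of_forall fun N => measureReal_nonneg) ?_ hlim
    filter_upwards [hr.eventually_le_const (show (0 : ℝ) < 1 / 2 by norm_num),
      hq.eventually_le_const (show (0 : ℝ) < 1 / 2 by norm_num), hMt.eventually_ge_atTop 2, hMle]
      with N h1 h2 h3 h4
    exact measureReal_not_exists_injective_le (hX N) (hlaw N) h3 h4.1 rfl h1 rfl h2
  have hB₂ : Tendsto (fun N => μ.real (B₂ N)) atTop (𝓝 0) := by
    refine squeeze_zero' (Eventually.of_forall fun N => measureReal_nonneg) ?_
      (tendsto_mul_exp_neg_pow (tendsto_natCast_atTop_of_abs_sub_log_lt hε hM)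
        (show 0 < η / 2 * η by positivity))
    filter_upwards [hMt.eventually_ge_atTop 1, hMle] with N h3 h4
    exact measureReal_exists_disjoint_le (hX N) (hlaw N) h3 h4.1 hη
  have hB₃ : Tendsto (fun N => μ.real (B₃ N)) atTop (𝓝 0) := by
    refine squeeze_zero' (Eventually.of_forall fun N => measureReal_nonneg) ?_
      (tendsto_pow_mul_exp_neg_sqrt hε hM)
    filter_upwards [hMt.eventually_ge_atTop 1, hMle] with N h3 h4
    exact measureReal_exists_card_lt_le (hσ N) (hlaw N) h3 h4.1
      (by have := Real.log_natCast_nonneg N; positivity)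
  have hB₄ : Tendsto (fun N => μ.real (B₄ N)) atTop (𝓝 0) := by
    refine squeeze_zero' (Eventually.of_forall fun N => measureReal_nonneg) ?_
      tendsto_inv_atTop_nhds_zero_nat
    filter_upwards [eventually_gt_atTop 0] with N hN
    have hN0 : (0 : ℝ) < N := by exact_mod_cast hN
    refine (measureReal_exists_lt_le (X := X N) (hσ N) (h_rayleigh N)
      (by have := Real.log_natCast_nonneg N; positivity)).trans_eq ?_
    have : Real.exp (-(3 * Real.log N)) = ((N : ℝ) ^ 3)⁻¹ := by
      rw [Real.exp_neg]
      congr 1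
      have := Real.exp_nat_mul (Real.log N) 3
      rw [Real.exp_log hN0] at this
      exact_mod_cast this
    rw [this]
    field_simp
  refine ⟨fun N => B₁ N ∪ B₂ N ∪ B₃ N ∪ B₄ N, ?_, ?_⟩
  · have hlim := ((hB₁.add hB₂).add hB₃).add hB₄
    simp only [add_zero] at hlim
    refine squeeze_zero (fun N => measureReal_nonneg) (fun N => ?_) hlim
    exact (measureReal_union_le _ _).trans (add_le_add_left ((measureReal_union_le _ _).trans
      (add_le_add_left (measureReal_union_le _ _) _)) _)
  have hratio := (tendsto_logb_div_logb (half_pos hsnrMin)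
    (show 0 < 3 * snrMax by positivity)).eventually_const_lt (show 1 - δ / 2 < 1 by linarith)
  filter_upwards [hratio, hMt.eventually_ge_atTop 1, hMle,
    tendsto_log_natCast_atTop.eventually_gt_atTop 0] with N hratio h1 hMle hlog ω hω
  simp only [Set.mem_union, not_or] at hω
  obtain ⟨⟨⟨hω₁, hω₂⟩, hω₃⟩, hω₄⟩ := hω
  have hgain : ∀ n, (S N ω).directGain n = X N n ω := by intro n; rw [hS]; rfl
  have hpow : (S N ω).power = P N := by rw [hS]
  have hwt : (S N ω).weight = w N := by rw [hS]
  have hnoise : (S N ω).noise = N₀ := by rw [hS]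
  have hSP : ∀ n, 0 < (S N ω).power n := by rw [hpow]; exact hP N
  have hSN : 0 < (S N ω).noise := by rw [hnoise]; exact hN₀
  have hmem : ∀ n k, k ∈ topSet (M N) (X N n ω) ↔
      (S N ω).orderedGain n (N - M N + 1) ≤ (S N ω).directGain n k := by
    intro n k
    rw [mem_topSet_iff_orderStat_le h1 hMle.1, Network.orderedGain, hgain]
  have hlowGain : ∀ n, σ N n * √(2 * (Real.log N / 2)) ≤
      (S N ω).orderedGain n (N - M N + 1) := by
    intro n
    rw [Network.orderedGain, hgain]
    refine le_orderStat_of_card h1 hMle.1 ?_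
    by_contra hlt
    exact hω₃ ⟨n, not_le.1 hlt⟩
  have huppGain : ∀ n, (S N ω).orderedGain n N ≤ σ N n * √(2 * (3 * Real.log N)) := by
    intro n
    obtain ⟨k, hk⟩ := exists_orderStat_eq (x := (S N ω).directGain n) (i := N)
      (by omega) le_rfl
    refine hk.le.trans ?_
    rw [hgain]
    by_contra hlt
    exact hω₄ ⟨n, k, not_le.1 hlt⟩
  have hpos : ∀ n, 0 < (S N ω).orderedGain n (N - M N + 1) := fun n =>
    lt_of_lt_of_le (mul_pos (hσ N n) (Real.sqrt_pos.2 (by positivity))) (hlowGain n)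
  have hrate : ∀ (n : Fin N) {v : ℝ}, 0 ≤ v → P N n / N₀ * (σ N n * √(2 * v)) ^ 2 =
      P N n * (2 * σ N n ^ 2) / N₀ * v := by
    intro n v hv
    rw [mul_pow, Real.sq_sqrt (by positivity)]
    ring
  have hlow : ∀ n, Real.logb 2 (1 + snrMin / 2 * Real.log N) ≤ Real.logb 2 (1 +
      (S N ω).power n / (S N ω).noise * (S N ω).orderedGain n (N - M N + 1) ^ 2) := by
    intro n
    refine Real.logb_le_logb_of_le (by norm_num) (by positivity) (add_le_add le_rfl ?_)
    rw [hpow, hnoise]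
    have hPn := hP N n
    have hσn := hσ N n
    calc snrMin / 2 * Real.log N = snrMin * (Real.log N / 2) := by ring
      _ ≤ P N n * (2 * σ N n ^ 2) / N₀ * (Real.log N / 2) := by
        gcongr
        exact (hsnr N n).1
      _ = P N n / N₀ * (σ N n * √(2 * (Real.log N / 2))) ^ 2 := (hrate n (by positivity)).symm
      _ ≤ _ := by
        gcongr
        exact hlowGain n
  have hupp : ∀ n, Real.logb 2 (1 + (S N ω).power n / (S N ω).noise *
      (S N ω).orderedGain n N ^ 2) ≤ Real.logb 2 (1 + 3 * snrMax * Real.log N) := by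
    intro n
    rw [hpow, hnoise]
    have hPn := hP N n
    have hσn := hσ N n
    refine Real.logb_le_logb_of_le (by norm_num) (by positivity) (add_le_add le_rfl ?_)
    have h0 : 0 ≤ (S N ω).orderedGain n N := by
      obtain ⟨k, hk⟩ := exists_orderStat_eq (x := (S N ω).directGain n) (i := N)
        (by omega) le_rfl
      rw [Network.orderedGain, hk]
      exact norm_nonneg _
    calc _ ≤ P N n / N₀ * (σ N n * √(2 * (3 * Real.log N))) ^ 2 := by
          gcongr
          exact huppGain n
      _ = P N n * (2 * σ N n ^ 2) / N₀ * (3 * Real.log N) := hrate n (by positivity)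
      _ ≤ snrMax * (3 * Real.log N) := by
          gcongr
          exact (hsnr N n).2
      _ = _ := by ring
  have hne : ((S N ω).mFSIG (M N)).pneSet.Nonempty := by
    obtain ⟨a, ha, hmema⟩ := not_not.1 hω₁
    exact ⟨a, (S N ω).mem_pneSet_of_injective hSP hSN ha fun n => (hmem n (a n)).1 (hmema n)⟩
  have key : ∀ a ∈ ((S N ω).mFSIG (M N)).pneSet, 0 < (S N ω).idealSumRate ∧
      (Real.logb 2 (1 + snrMin / 2 * Real.log N) / Real.logb 2 (1 + 3 * snrMax * Real.log N) -
        η * (wmax / wmin)) * (S N ω).idealSumRate ≤ (S N ω).weightedSumRate a := by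
    intro a ha
    refine (S N ω).mul_idealSumRate_le_weightedSumRate h1 hMle.1 hSP hSN hwmin
      (by rw [hwt]; exact hw N) (Real.logb_pos (by norm_num) (lt_add_of_pos_right _ (by positivity)))
      hη.le hlow hupp hpos ha ?_
    by_contra! hlt
    -- Too many interfered users, together with the free channels, would be a pair forbidden off
    -- `B₂`; the factor `2` in the counting bound is the reason for `η / 2` there.
    refine hω₂ ⟨_, Finset.univ \ Finset.univ.image a, hlt.le, ?_, fun n hn => ?_⟩
    · have : (Finset.card {n | 0 < (S N ω).interference a n (a n)} : ℝ) ≤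
          2 * (Finset.univ \ Finset.univ.image a).card := by
        exact_mod_cast (S N ω).card_interfered_le a
      linarith
    · rw [Finset.disjoint_left]
      intro k hk
      simp only [Finset.mem_sdiff, Finset.mem_univ, true_and, not_not]
      exact (S N ω).not_mem_image_of_mem_pneSet h1 hMle.1 hSP hSN ha n (hpos n)
        (by simpa using hn) ((hmem n k).1 hk)
  obtain ⟨a₀, ha₀⟩ := hne
  refine ⟨⟨a₀, ha₀⟩, (key a₀ ha₀).1, fun a ha => ?_⟩
  refine lt_of_lt_of_le ?_ (key a ha).2
  refine mul_lt_mul_of_pos_right ?_ (key a ha).1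
  have : η * (wmax / wmin) = δ / 2 := by
    rw [hη_def]
    field_simp
  linarith

end RandomNetwork

theorem mainTheorem2
    {Ω : Type*} [MeasurableSpace Ω] (μ : Measure Ω) [IsProbabilityMeasure μ]
    -- for each `N`, the random coefficients of a network with `N` users and `N` channels
    (h : (N : ℕ) → Fin N → Fin N → Fin N → Ω → ℂ)
    (h_meas : ∀ N m n k, Measurable (h N m n k))
    (h_indep : ∀ N, iIndepFun (fun p : Fin N × Fin N × Fin N => h N p.1 p.2.1 p.2.2) μ)
    -- the direct coefficients of each user are Rayleigh
    (σ : (N : ℕ) → Fin N → ℝ) (hσ : ∀ N n, 0 < σ N n)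
    (h_rayleigh : ∀ N n k, HasLaw (fun ω => ‖h N n n k ω‖) (rayleighMeasure (σ N n)) μ)
    -- weights, powers, noise
    (w : (N : ℕ) → Fin N → ℝ) (wmin wmax : ℝ) (hwmin : 0 < wmin)
    (hw : ∀ N n, wmin ≤ w N n ∧ w N n ≤ wmax)
    (N₀ : ℝ) (hN₀ : 0 < N₀)
    (P : (N : ℕ) → Fin N → ℝ) (hP : ∀ N n, 0 < P N n)
    -- the mean signal-to-noise ratios `P_n E|h_{n,k}|² / N₀ = 2 P_n σ_n² / N₀` are bounded
    (snrMin snrMax : ℝ) (hsnrMin : 0 < snrMin)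
    (hsnr : ∀ N n, snrMin ≤ P N n * (2 * σ N n ^ 2) / N₀ ∧
      P N n * (2 * σ N n ^ 2) / N₀ ≤ snrMax)
    -- `M_N` is `(1 + ε) ln N`, rounded to an integer
    (ε : ℝ) (hε : 0 < ε) (M : ℕ → ℕ)
    (hM : ∀ N, |(M N : ℝ) - (1 + ε) * Real.log N| < 1) :
    let S : (N : ℕ) → Ω → Network N := fun N ω =>
      { gain := fun m n k => h N m n k ω, power := P N, weight := w N, noise := N₀ }
    -- uniformly over the pure Nash equilibria, the ratio tends to `1` in probability
    (∀ δ : ℝ, 0 < δ →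
      Tendsto (fun N => μ {ω | ∃ a ∈ ((S N ω).mFSIG (M N)).pneSet,
        δ ≤ |(S N ω).weightedSumRate a / (S N ω).idealSumRate - 1|}) atTop (𝓝 0)) ∧
    -- with probability tending to `1` there is a pure Nash equilibrium, and the pure price of
    -- anarchy tends to `1` in probability
    Tendsto (fun N => μ {ω | ((S N ω).mFSIG (M N)).pneSet.Nonempty}) atTop (𝓝 1) ∧
    TendstoInMeasure μ
      (fun N ω => ((S N ω).mFSIG (M N)).purePriceOfAnarchy (S N ω).weightedSumRate)
      atTop (fun _ => 1) := by
  intro S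
  have key := fun {δ : ℝ} (hδ : 0 < δ) => exists_exceptional_sets h h_meas h_indep σ hσ h_rayleigh
    w wmin wmax hwmin hw N₀ hN₀ P hP snrMin snrMax hsnrMin hsnr ε hε M hM S rfl hδ
  have hSP : ∀ N ω n, 0 < (S N ω).power n := fun N _ n => hP N n
  have hSw : ∀ N ω n, 0 ≤ (S N ω).weight n := fun N _ n => hwmin.le.trans (hw N n).1
  refine ⟨fun δ hδ => ?_, ?_, ?_⟩
  · obtain ⟨B, hB, hev⟩ := key hδ
    refine tendsto_measure_of_eventually_subset hB (hev.mono fun N hN ω hω => ?_)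
    by_contra hωB
    obtain ⟨-, hideal, hlow⟩ := hN ω hωB
    obtain ⟨a, ha, hdev⟩ := hω
    have h1 : (S N ω).weightedSumRate a / (S N ω).idealSumRate ≤ 1 :=
      (div_le_one hideal).2
        ((S N ω).weightedSumRate_le_idealSumRate (hSP N ω) hN₀ (hSw N ω) a)
    have h2 : 1 - δ < (S N ω).weightedSumRate a / (S N ω).idealSumRate :=
      (lt_div_iff₀ hideal).2 (hlow a ha)
    refine absurd hdev (not_le.2 (abs_lt.2 ⟨?_, ?_⟩)) <;> linarith
  · obtain ⟨B, hB, hev⟩ := key one_pos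
    refine tendsto_measure_one_of_eventually_compl_subset hB (hev.mono fun N hN ω hω => ?_)
    by_contra hωB
    exact hω (hN ω hωB).1
  · refine tendstoInMeasure_iff_dist.2 fun δ hδ => ?_
    -- Chosen so that the reciprocal of `1 - δ / (2 + δ)` is `1 + δ / 2`, strictly below `1 + δ`.
    have hδ' : 0 < δ / (2 + δ) := by positivity
    obtain ⟨B, hB, hev⟩ := key hδ'
    refine tendsto_measure_of_eventually_subset hB (hev.mono fun N hN ω hω => ?_)
    by_contra hωB
    obtain ⟨hne, hideal, hlow⟩ := hN ω hωB
    have hc : 1 - δ / (2 + δ) = 2 / (2 + δ) := by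
      field_simp
      ring
    obtain ⟨h1, h2⟩ := (S N ω).purePriceOfAnarchy_bounds (M := M N) (hSP N ω) hN₀ (hSw N ω) hideal
      (c := 1 - δ / (2 + δ)) (by rw [hc]; positivity) hne fun a ha => (hlow a ha).le
    have hinv : (1 - δ / (2 + δ))⁻¹ = 1 + δ / 2 := by
      rw [hc, inv_div]
      ring
    rw [hinv] at h2
    have hω' : δ ≤ |((S N ω).mFSIG (M N)).purePriceOfAnarchy (S N ω).weightedSumRate - 1| := hω
    refine absurd hω' (not_le.2 (abs_lt.2 ⟨?_, ?_⟩)) <;> linarith
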